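/- Let $M=(m_{s,t})_{s,t\in S}$ be a Coxeter matrix over a finite set $S$, with associated Coxeter graph $\Gamma$ (vertex set $S$; $s\neq t$ are joined by an edge when $3\le m_{s,t}\le\infty$, labelled by $m_{s,t}$ when $m_{s,t}\ge 4$), and let $(W,S)$ be the Coxeter system of type $\Gamma$. Assume that $\Gamma$ is connected (in particular non-empty) and of spherical type, i.e. the symmetric bilinear form on $\bigoplus_{s\in S}\mathbb{R}\alpha_s$ with $\langle\alpha_s,\alpha_t\rangle=-\cos(\pi/m_{s,t})$ (and $-1$ if $m_{s,t}=\infty$) is positive definite; equivalently, $\Gamma$ is connected and $W$ is finite. Call a group decomposable if it has a direct factor that is neither trivial nor the whole group, and indecomposable otherwise. A Remak decomposition of a group is a decomposition as an internal direct product of finitely many non-trivial indecomposable subgroups. Then $W$ is decomposable if and only if $\Gamma$ is isomorphic, as a labelled graph, to one of $$I_2(p)\ (p\ge 6,\ p\equiv 2 \bmod 4),\qquad B_n\ (n\ge 3 \text{ odd}),\qquad H_3,\qquad E_7 .$$ In that case $W$ has a Remak decomposition $W=H_1\times H_2$ with $H_1\cong Z(W)$ and $H_2\cong W/Z(W)$,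 and every Remak decomposition of $W$ has exactly two factors, one isomorphic to $Z(W)$ and the other to $W/Z(W)$. -/

import Mathlib

/-- `H` is a direct factor of `G`: there is a subgroup `K` with `G = H × K`
(internal direct product). -/
def Subgroup.IsDirectFactor {G : Type*} [Group G] (H : Subgroup G) : Prop :=
  ∃ K : Subgroup G, IsCompl H K ∧ ∀ h ∈ H, ∀ k ∈ K, Commute h k

/-- A group is indecomposable if it has no proper non-trivial direct factor. -/
def IsIndecomposableGroup (G : Type*) [Group G] : Prop :=
  ∀ H : Subgroup G, H.IsDirectFactor → H = ⊥ ∨ H = ⊤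

/-- A group is decomposable if it is not indecomposable. -/
def IsDecomposableGroup (G : Type*) [Group G] : Prop :=
  ¬ IsIndecomposableGroup G

/-- `G = H 0 × ⋯ × H (q - 1)` is a Remak decomposition: `G` is the internal direct product of the
finite family `H`, and every `H i` is non-trivial and indecomposable. -/
structure IsRemakDecomposition {G : Type*} [Group G] {q : ℕ} (H : Fin q → Subgroup G) : Prop where
  /-- distinct factors commute elementwise -/
  commute : ∀ i j, i ≠ j → ∀ x ∈ H i, ∀ y ∈ H j, Commute x y
  /-- each factor meets the subgroup generated by the other ones trivially -/
  independent : iSupIndep H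
  /-- the factors generate the group -/
  generate : ⨆ i, H i = ⊤
  nontrivial : ∀ i, Nontrivial (H i)
  indecomposable : ∀ i, IsIndecomposableGroup (H i)

namespace CoxeterMatrix

/-- The underlying graph of the Coxeter graph of `M`: distinct `s`, `t` are joined by an edge
if and only if `m_{s t} ≥ 3` or `m_{s t} = ∞` (the entry `0` of `M` encodes `∞`). -/
def coxeterGraph {B : Type*} (M : CoxeterMatrix B) : SimpleGraph B where
  Adj s t := s ≠ t ∧ (3 ≤ M s t ∨ M s t = 0)
  symm := ⟨fun s t h => ⟨h.1.symm, by rw [M.symmetric t s]; exact h.2⟩⟩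
  loopless := ⟨fun _ h => h.1 rfl⟩

/-- The Gram matrix of the canonical form in the basis of simple roots:
`⟨α_s, α_t⟩ = -cos (π / m_{s t})`, and `-1` if `m_{s t} = ∞`. -/
noncomputable def canonicalForm {B : Type*} (M : CoxeterMatrix B) : Matrix B B ℝ :=
  Matrix.of fun s t => if M s t = 0 then -1 else -Real.cos (Real.pi / (M s t : ℝ))

/-- `M` is of spherical type if its canonical form is positive definite. -/
def IsSpherical {B : Type*} (M : CoxeterMatrix B) : Prop :=
  M.canonicalForm.PosDef

/-- The labelled Coxeter graphs of `M` and `N` are isomorphic: the two Coxeter matrices agree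
up to renaming the vertices. -/
def SameType {B B' : Type*} (M : CoxeterMatrix B) (N : CoxeterMatrix B') : Prop :=
  ∃ e : B ≃ B', M.reindex e = N

end CoxeterMatrix

/-! The geometric representation embeds `W` in the orthogonal group of a Euclidean space. A
non-trivial central element sends each simple root to plus or minus itself, with a sign that is
constant along edges, so it acts as -1; hence the centre has order at most two. If two commuting
subgroups generate `W`, one of them is central (`le_center_or_le_center`): every simple reflection
commutes with all of one factor (`forall_commute_or`), and connectedness makes the choice uniform.
So a proper decomposition is the centre times a complement, which settles the Remak decompositions,
and for non-abelian `W` decomposability means that some character `W →* ℤˣ` is -1 on a central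
element (`isDecomposableGroup_iff`).

It remains to find the diagrams with such a character `φ`. If all labels are odd, `φ` must be the
sign character, which is the determinant, so its value at -1 forces odd rank. Characters that factor
through a homomorphism onto a symmetric group of degree at least 3 die on the centre
(`IsFolding.eq_one`); this removes types A and D, and paths of even rank with a single label 4. A
map to the dihedral group of order 8 removes `I₂(p)` with `4 ∣ p`. The part of the classification
needed to name the remaining diagrams comes from positive definiteness, by test vectors of
non-positive norm supported on forbidden subdiagrams (`HasBody`).

Conversely, types `B_n` with `n` odd, `H₃` and `E₇` have odd rank and contain -1, so the sign
character works; for `I₂(p)` with `p ≡ 2 mod 4` a half turn and a character separating the two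
simple reflections do. -/

set_option linter.unusedSectionVars false

open Real

/-! ### The canonical form and the simple reflections. -/

namespace CoxeterMatrix

section Form

variable {S : Type*} [Fintype S] [DecidableEq S] (M : CoxeterMatrix S)

/-- The simple root `α_s`. -/
def simpleRoot (s : S) : S → ℝ := Pi.single s 1

/-- The canonical bilinear form on the space spanned by the simple roots. -/
noncomputable def rootForm : LinearMap.BilinForm ℝ (S → ℝ) := Matrix.toBilin' M.canonicalForm

theorem canonicalForm_symm (s t : S) : M.canonicalForm s t = M.canonicalForm t s := by
  simp [canonicalForm, M.symmetric s t]

@[simp] theorem canonicalForm_self (s : S) : M.canonicalForm s s = 1 := by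
  simp [canonicalForm]

@[simp] theorem rootForm_simpleRoot (s t : S) :
    M.rootForm (simpleRoot s) (simpleRoot t) = M.canonicalForm s t := by
  simp [rootForm, simpleRoot, Matrix.toBilin'_single]

theorem rootForm_apply (x y : S → ℝ) :
    M.rootForm x y = ∑ s, ∑ t, x s * M.canonicalForm s t * y t := by
  simp [rootForm, Matrix.toBilin'_apply]

theorem rootForm_comm (x y : S → ℝ) : M.rootForm x y = M.rootForm y x := by
  rw [rootForm_apply, rootForm_apply, Finset.sum_comm]
  refine Finset.sum_congr rfl fun s _ => Finset.sum_congr rfl fun t _ => ?_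
  rw [M.canonicalForm_symm]; ring

variable {M}

theorem IsSpherical.rootForm_pos (h : M.IsSpherical) {x : S → ℝ} (hx : x ≠ 0) :
    0 < M.rootForm x x := by
  have := Matrix.PosDef.dotProduct_mulVec_pos h hx
  simpa [rootForm, Matrix.toBilin'_apply'] using this

theorem simpleRoot_ne_zero (s : S) : simpleRoot s ≠ 0 := by
  simp [simpleRoot]

theorem simpleRoot_apply (s t : S) : simpleRoot s t = if t = s then 1 else 0 := by
  simp [simpleRoot, Pi.single_apply]

theorem IsSpherical.ne_zero (h : M.IsSpherical) (s t : S) : M s t ≠ 0 := by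
  intro h0
  have hne : s ≠ t := by rintro rfl; simp at h0
  have hx : simpleRoot s + simpleRoot t ≠ 0 := by
    intro hx
    have := congrFun hx s
    simp [simpleRoot_apply, hne] at this
  have := h.rootForm_pos hx
  simp only [map_add, LinearMap.add_apply, rootForm_simpleRoot, canonicalForm_self,
    M.canonicalForm_symm t s] at this
  have h1 : M.canonicalForm s t = -1 := by simp [canonicalForm, h0]
  rw [h1] at this
  norm_num at this

theorem IsSpherical.two_le (h : M.IsSpherical) {s t : S} (hst : s ≠ t) : 2 ≤ M s t := by
  have h1 := M.off_diagonal s t hst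
  have h0 := h.ne_zero s t
  change M s t ≠ 1 at h1
  omega

theorem IsSpherical.canonicalForm_eq (h : M.IsSpherical) (s t : S) :
    M.canonicalForm s t = -cos (π / M s t) := by
  simp [canonicalForm, h.ne_zero s t]

variable (M) in
/-- The orthogonal reflection in the simple root `α_s`. -/
noncomputable def simpleReflection (s : S) : Module.End ℝ (S → ℝ) :=
  LinearMap.id - (2 : ℝ) • (M.rootForm (simpleRoot s)).smulRight (simpleRoot s)

theorem simpleReflection_apply (s : S) (x : S → ℝ) :
    M.simpleReflection s x = x - (2 * M.rootForm (simpleRoot s) x) • simpleRoot s := by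
  simp [simpleReflection, mul_smul]

theorem simpleReflection_simpleRoot (s t : S) :
    M.simpleReflection s (simpleRoot t) =
      simpleRoot t - (2 * M.canonicalForm s t) • simpleRoot s := by
  simp [simpleReflection_apply]

theorem simpleReflection_simpleReflection (s : S) (x : S → ℝ) :
    M.simpleReflection s (M.simpleReflection s x) = x := by
  simp only [simpleReflection_apply, map_sub, map_smul, rootForm_simpleRoot, canonicalForm_self]
  module

theorem rootForm_simpleReflection (s : S) (x y : S → ℝ) :
    M.rootForm (M.simpleReflection s x) (M.simpleReflection s y) = M.rootForm x y := by
  simp only [simpleReflection_apply, map_sub, map_smul, rootForm_simpleRoot, canonicalForm_self,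
    smul_eq_mul, LinearMap.sub_apply, LinearMap.smul_apply, M.rootForm_comm x (simpleRoot s)]
  ring

/-- Powers of the product of two simple reflections, applied to the first root. -/
theorem simpleReflection_mul_pow_fst (h : M.IsSpherical) (s t : S) (k : ℕ) :
    sin (π / M s t) • ((M.simpleReflection s * M.simpleReflection t) ^ k) (simpleRoot s) =
      sin ((2 * k + 1) * (π / M s t)) • simpleRoot s + sin (2 * k * (π / M s t)) • simpleRoot t := by
  set θ := π / M s t with hθ
  have hc : M.canonicalForm s t = -cos θ := h.canonicalForm_eq s t
  have hc' : M.canonicalForm t s = -cos θ := by rw [M.canonicalForm_symm]; exact hc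
  induction k with
  | zero => simp
  | succ k ih =>
    rw [pow_succ', Module.End.mul_apply, ← map_smul, ih, Module.End.mul_apply]
    simp only [map_add, map_smul, simpleReflection_simpleRoot, hc, hc', map_sub,
      canonicalForm_self]
    -- Both coefficients obey sin (x + θ) = 2 sin x cos θ - sin (x - θ), which is exactly how the
    -- two reflections change them.
    have e1 : sin ((2 * ((k + 1 : ℕ) : ℝ)) * θ) =
        2 * sin ((2 * k + 1) * θ) * cos θ - sin (2 * k * θ) := by
      have : (2 * ((k + 1 : ℕ) : ℝ)) * θ = (2 * k + 1) * θ + θ := by push_cast; ring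
      have h2 : 2 * k * θ = (2 * k + 1) * θ - θ := by ring
      rw [this, h2, sin_add, sin_sub]; ring
    have e2 : sin ((2 * ((k + 1 : ℕ) : ℝ) + 1) * θ) =
        2 * sin ((2 * ((k + 1 : ℕ) : ℝ)) * θ) * cos θ - sin ((2 * k + 1) * θ) := by
      have : (2 * ((k + 1 : ℕ) : ℝ) + 1) * θ = (2 * ((k + 1 : ℕ) : ℝ)) * θ + θ := by ring
      have h2 : (2 * k + 1) * θ = (2 * ((k + 1 : ℕ) : ℝ)) * θ - θ := by push_cast; ring
      rw [this, h2, sin_add, sin_sub]; ring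
    rw [e2, e1]
    module

theorem IsSpherical.sin_pos (h : M.IsSpherical) {s t : S} (hst : s ≠ t) :
    0 < sin (π / M s t) := by
  have h2 : (2 : ℝ) ≤ M s t := by exact_mod_cast h.two_le hst
  apply sin_pos_of_pos_of_lt_pi
  · have := pi_pos; positivity
  · rw [div_lt_iff₀ (by linarith)]; nlinarith [pi_pos]

theorem simpleReflection_mul_pow_root (h : M.IsSpherical) {s t : S} (hst : s ≠ t) :
    ((M.simpleReflection s * M.simpleReflection t) ^ M s t) (simpleRoot s) = simpleRoot s := by
  have h0 : (M s t : ℝ) ≠ 0 := by exact_mod_cast h.ne_zero s t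
  have hs := h.sin_pos hst
  have := simpleReflection_mul_pow_fst h s t (M s t)
  have e1 : (2 * (M s t : ℝ) + 1) * (π / M s t) = π / M s t + 2 * π := by field_simp; ring
  have e2 : 2 * (M s t : ℝ) * (π / M s t) = 2 * π := by field_simp
  rw [e1, e2, sin_add_two_pi, sin_two_pi, zero_smul, add_zero] at this
  exact smul_right_injective _ hs.ne' this

theorem pow_apply_of_apply_eq {V : Type*} [AddCommGroup V] [Module ℝ V] {f : Module.End ℝ V}
    {x : V} (hx : f x = x) (n : ℕ) : (f ^ n) x = x := by
  induction n with
  | zero => simp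
  | succ n ih => rw [pow_succ, Module.End.mul_apply, hx, ih]

/-- The space is the plane of `α_s`, `α_t` plus its orthogonal complement. The power fixes both
roots by the sine formula, and each reflection fixes the complement. -/
theorem isLiftable_simpleReflection (h : M.IsSpherical) : M.IsLiftable M.simpleReflection := by
  intro s t
  rcases eq_or_ne s t with rfl | hst
  · ext1 x; ext1; simp [simpleReflection_simpleReflection]
  have hp : ∀ {s t : S}, s ≠ t →
      ((M.simpleReflection s * M.simpleReflection t) ^ M s t) (simpleRoot s) = simpleRoot s :=
    fun hst => simpleReflection_mul_pow_root h hst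
  have hinv : ∀ x, ((M.simpleReflection s * M.simpleReflection t) ^ M s t)
      (((M.simpleReflection t * M.simpleReflection s) ^ M s t) x) = x := by
    intro x
    rw [← Module.End.mul_apply]
    have hc : (M.simpleReflection s * M.simpleReflection t) *
        (M.simpleReflection t * M.simpleReflection s) = 1 := by
      ext1 x; ext1; simp [simpleReflection_simpleReflection]
    have hc' : (M.simpleReflection t * M.simpleReflection s) *
        (M.simpleReflection s * M.simpleReflection t) = 1 := by
      ext1 x; ext1; simp [simpleReflection_simpleReflection]
    have : Commute (M.simpleReflection s * M.simpleReflection t)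
        (M.simpleReflection t * M.simpleReflection s) := by
      rw [Commute, SemiconjBy, hc, hc']
    rw [← this.mul_pow, hc, one_pow, Module.End.one_apply]
  have hα := hp hst
  -- The inverse power, with `s` and `t` exchanged, fixes `α_t`.
  have hβ : ((M.simpleReflection s * M.simpleReflection t) ^ M s t) (simpleRoot t) =
      simpleRoot t := by
    have := hp hst.symm
    rw [M.symmetric] at this
    conv_lhs => rw [← this]
    rw [hinv]
  apply LinearMap.ext
  intro x
  set c := M.canonicalForm s t with hc
  have hc1 : 1 - c ^ 2 ≠ 0 := by
    have := h.sin_pos hst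
    rw [hc, h.canonicalForm_eq s t]
    have h2 := sin_sq_add_cos_sq (π / M s t)
    have : 1 - (-cos (π / M s t)) ^ 2 = sin (π / M s t) ^ 2 := by linarith [neg_sq (cos (π / M s t))]
    rw [this]; positivity
  -- `a` and `b` solve the Gram system of the plane, whose determinant is 1 - c² = sin² (π / m); so
  -- `y` is the component of `x` orthogonal to it.
  set a := (M.rootForm (simpleRoot s) x - c * M.rootForm (simpleRoot t) x) / (1 - c ^ 2) with ha
  set b := (M.rootForm (simpleRoot t) x - c * M.rootForm (simpleRoot s) x) / (1 - c ^ 2) with hb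
  set y := x - (a • simpleRoot s + b • simpleRoot t) with hy
  have hys : M.rootForm (simpleRoot s) y = 0 := by
    simp only [hy, map_sub, map_add, map_smul, rootForm_simpleRoot, canonicalForm_self,
      smul_eq_mul, ← hc, ha, hb]
    field_simp
    ring
  have hyt : M.rootForm (simpleRoot t) y = 0 := by
    simp only [hy, map_sub, map_add, map_smul, rootForm_simpleRoot, canonicalForm_self,
      smul_eq_mul, M.canonicalForm_symm t s, ← hc, ha, hb]
    field_simp
    ring
  have hfix : ((M.simpleReflection s * M.simpleReflection t) ^ M s t) y = y := by
    apply pow_apply_of_apply_eq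
    simp [simpleReflection_apply, hys, hyt]
  have hx : x = y + (a • simpleRoot s + b • simpleRoot t) := by simp [hy]
  rw [hx]
  simp only [map_add, map_smul, hα, hβ, hfix, Module.End.one_apply]

end Form

end CoxeterMatrix

/-! ### Faithfulness of the geometric representation. -/

namespace CoxeterSystem

open CoxeterMatrix

variable {S : Type*} [Fintype S] [DecidableEq S] {M : CoxeterMatrix S}
  {W : Type*} [Group W] (cs : CoxeterSystem M W)

/-- The canonical (geometric) representation of a Coxeter group of spherical type. -/
noncomputable def geomRep (h : M.IsSpherical) : W →* Module.End ℝ (S → ℝ) :=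
  cs.lift ⟨M.simpleReflection, isLiftable_simpleReflection h⟩

variable (h : M.IsSpherical)

@[simp] theorem geomRep_simple (s : S) : cs.geomRep h (cs.simple s) = M.simpleReflection s :=
  cs.lift_apply_simple _ s

theorem rootForm_geomRep (w : W) (x y : S → ℝ) :
    M.rootForm (cs.geomRep h w x) (cs.geomRep h w y) = M.rootForm x y := by
  induction w using cs.simple_induction_left generalizing x y with
  | one => simp
  | mul_simple_left w s ih => simp [map_mul, rootForm_simpleReflection, ih]

theorem geomRep_inv_apply_self (w : W) (x : S → ℝ) :
    cs.geomRep h w⁻¹ (cs.geomRep h w x) = x := by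
  rw [← Module.End.mul_apply, ← map_mul]; simp

theorem geomRep_self_apply_inv (w : W) (x : S → ℝ) :
    cs.geomRep h w (cs.geomRep h w⁻¹ x) = x := by
  rw [← Module.End.mul_apply, ← map_mul]; simp

theorem geomRep_simple_simpleRoot_self (s : S) :
    cs.geomRep h (cs.simple s) (simpleRoot s) = - simpleRoot s := by
  rw [geomRep_simple, simpleReflection_simpleRoot, canonicalForm_self]
  module

/-- A short alternating word maps the simple root to a non-negative combination. -/
theorem geomRep_alternatingWord {s t : S} (hst : s ≠ t) {k : ℕ} (hk : k < M s t) :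
    ∃ a b : ℝ, 0 ≤ a ∧ 0 ≤ b ∧
      cs.geomRep h (cs.wordProd (alternatingWord s t k)) (simpleRoot s) =
        a • simpleRoot s + b • simpleRoot t := by
  have hs := h.sin_pos hst
  have h0 : (0 : ℝ) < M s t := by exact_mod_cast Nat.pos_of_ne_zero (h.ne_zero s t)
  -- The coefficients will be sin (jθ) / sin θ with j ≤ m, so their angles stay in [0, π].
  have hnn : ∀ j : ℕ, j ≤ M s t → 0 ≤ sin (j * (π / M s t)) := by
    intro j hj
    apply sin_nonneg_of_nonneg_of_le_pi
    · have := pi_pos; positivity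
    · have : (j : ℝ) ≤ M s t := by exact_mod_cast hj
      rw [mul_div_assoc', div_le_iff₀ h0]
      nlinarith [pi_pos]
  rw [prod_alternatingWord_eq_mul_pow, map_mul, map_pow, map_mul, Module.End.mul_apply,
    geomRep_simple, geomRep_simple]
  have key := simpleReflection_mul_pow_fst h s t (k / 2)
  set θ := π / M s t with hθ
  have hc : M.canonicalForm s t = -cos θ := h.canonicalForm_eq s t
  have key' : ((M.simpleReflection s * M.simpleReflection t) ^ (k / 2)) (simpleRoot s) =
      (sin θ)⁻¹ • (sin ((2 * (k / 2 : ℕ) + 1) * θ) • simpleRoot s +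
        sin (2 * (k / 2 : ℕ) * θ) • simpleRoot t) := by
    rw [← key, inv_smul_smul₀ hs.ne']
  rw [key']
  rcases Nat.even_or_odd' k with ⟨j, rfl | rfl⟩
  · have hj : 2 * j / 2 = j := by omega
    refine ⟨(sin θ)⁻¹ * sin ((2 * j + 1) * θ), (sin θ)⁻¹ * sin (2 * j * θ), ?_, ?_, ?_⟩
    · have := hnn (2 * j + 1) (by omega); push_cast at this; positivity
    · have := hnn (2 * j) (by omega); push_cast at this; positivity
    · simp only [hj, even_two, Even.mul_right, if_true, map_one, Module.End.one_apply]
      module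
  · have hj : (2 * j + 1) / 2 = j := by omega
    refine ⟨(sin θ)⁻¹ * sin ((2 * j + 1) * θ), (sin θ)⁻¹ * sin ((2 * j + 2) * θ), ?_, ?_, ?_⟩
    · have := hnn (2 * j + 1) (by omega); push_cast at this; positivity
    · have := hnn (2 * j + 2) (by omega); push_cast at this; positivity
    · have hodd : ¬ Even (2 * j + 1) := by simp
      have e1 : sin ((2 * j + 2) * θ) =
          2 * sin ((2 * j + 1) * θ) * cos θ - sin (2 * j * θ) := by
        have : (2 * j + 2) * θ = (2 * j + 1) * θ + θ := by ring
        have h2 : 2 * j * θ = (2 * j + 1) * θ - θ := by ring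
        rw [this, h2, sin_add, sin_sub]; ring
      simp only [hj, hodd, if_false, geomRep_simple, map_smul, map_add,
        simpleReflection_simpleRoot, M.canonicalForm_symm t s, hc, canonicalForm_self, e1]
      module

/-- If `ℓ (w s) > ℓ w` then `w` maps `α_s` to a non-negative combination of simple roots. -/
theorem geomRep_simpleRoot_nonneg (w : W) (s : S)
    (hw : cs.length w < cs.length (w * cs.simple s)) : 0 ≤ cs.geomRep h w (simpleRoot s) := by
  have hroot : ∀ s : S, (0 : S → ℝ) ≤ simpleRoot s := fun s => by
    simp [simpleRoot]
  induction hn : cs.length w using Nat.strong_induction_on generalizing w s with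
  | _ n ih =>
  by_cases hw1 : w = 1
  · subst hw1; simpa using hroot s
  obtain ⟨t, ht⟩ := cs.exists_rightDescent_of_ne_one hw1
  have hst : s ≠ t := by
    rintro rfl
    exact absurd ht (not_lt.2 hw.le)
  -- Split off on the right of `w` the longest alternating word in `s`, `t` ending in `t` with
  -- additive lengths. The remaining `v` is lengthened by both `s` and `t`, so induction applies to
  -- it at both roots.
  let P : ℕ → Prop := fun k => ∃ v : W, w = v * cs.wordProd (alternatingWord s t k) ∧
    cs.length v + k = cs.length w
  have hP1 : P 1 := by
    refine ⟨w * cs.simple t, ?_, ?_⟩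
    · simp [alternatingWord]
    · exact (cs.isRightDescent_iff).1 ht
  have hbd : ∀ k, P k → k ≤ cs.length w := by
    rintro k ⟨v, -, hv⟩; omega
  classical
  obtain ⟨k, hk1, hPk, hmax⟩ : ∃ k, 1 ≤ k ∧ P k ∧ ¬ P (k + 1) := by
    by_contra hcon
    push Not at hcon
    have : ∀ k, 1 ≤ k → P k := fun k hk => Nat.le_induction hP1 (fun k hk h => hcon k hk h) k hk
    have := hbd _ (this (cs.length w + 1) (by omega))
    omega
  obtain ⟨v, hwv, hlen⟩ := hPk
  -- Otherwise the word followed by `s` is longer than `m`, hence not reduced, against the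
  -- assumption that `w s` is longer than `w`.
  have hlt : k < M s t := by
    by_contra hle
    push Not at hle
    have hnr := cs.not_isReduced_alternatingWord t s (m := k + 1)
      (h.ne_zero t s) (by rw [M.symmetric t s]; exact Nat.lt_succ_of_le hle)
    have hle' := cs.length_wordProd_le (alternatingWord t s (k + 1))
    rw [length_alternatingWord] at hle'
    have hne : cs.length (cs.wordProd (alternatingWord t s (k + 1))) ≠ k + 1 := by
      intro he; apply hnr; rw [IsReduced, he, length_alternatingWord]
    have heq : w * cs.simple s = v * cs.wordProd (alternatingWord t s (k + 1)) := by
      rw [hwv, alternatingWord_succ, wordProd_concat, mul_assoc]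
    have h1 := cs.length_mul_le v (cs.wordProd (alternatingWord t s (k + 1)))
    rw [← heq] at h1
    omega
  -- the first letter of the alternating word and the letter preceding it
  have hcons : ∀ j, alternatingWord s t (j + 1) =
      (if Even j then t else s) :: alternatingWord s t j := fun j => alternatingWord_succ' s t j
  -- A descent of `v` in the letter that would extend the word contradicts the maximality of `k`.
  have hup : cs.length v < cs.length (v * cs.simple (if Even k then t else s)) := by
    by_contra hle
    apply hmax
    refine ⟨v * cs.simple (if Even k then t else s), ?_, ?_⟩
    · rw [hcons, wordProd_cons, mul_assoc, simple_mul_simple_cancel_left, hwv]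
    · have := cs.length_mul_simple v (if Even k then t else s)
      omega
  obtain ⟨j, rfl⟩ : ∃ j, k = j + 1 := ⟨k - 1, by omega⟩
  -- A descent of `v` in the first letter of the word would make `w` shorter than it is.
  have hup' : cs.length v < cs.length (v * cs.simple (if Even j then t else s)) := by
    by_contra hle
    have h1 : w = (v * cs.simple (if Even j then t else s)) *
        cs.wordProd (alternatingWord s t j) := by
      rw [hwv, hcons, wordProd_cons, mul_assoc]
    have h2 := cs.length_mul_le (v * cs.simple (if Even j then t else s))
        (cs.wordProd (alternatingWord s t j))
    rw [← h1] at h2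
    have h3 := cs.length_wordProd_le (alternatingWord s t j)
    rw [length_alternatingWord] at h3
    omega
  have hvs : 0 ≤ cs.geomRep h v (simpleRoot s) ∧ 0 ≤ cs.geomRep h v (simpleRoot t) := by
    have hvl : cs.length v < n := by omega
    by_cases hj : Even j
    · have hj1 : ¬ Even (j + 1) := by rw [Nat.even_add_one]; simpa using hj
      rw [if_pos hj] at hup'
      rw [if_neg hj1] at hup
      exact ⟨ih _ hvl v s hup rfl, ih _ hvl v t hup' rfl⟩
    · have hj1 : Even (j + 1) := by rw [Nat.even_add_one]; exact hj
      rw [if_neg hj] at hup'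
      rw [if_pos hj1] at hup
      exact ⟨ih _ hvl v s hup' rfl, ih _ hvl v t hup rfl⟩
  obtain ⟨a, b, ha, hb, hab⟩ := cs.geomRep_alternatingWord h hst hlt
  rw [hwv, map_mul, Module.End.mul_apply, hab, map_add, map_smul, map_smul]
  exact add_nonneg (smul_nonneg ha hvs.1) (smul_nonneg hb hvs.2)

/-- The canonical representation is faithful. -/
theorem geomRep_injective : Function.Injective (cs.geomRep h) := by
  rw [injective_iff_map_eq_one]
  intro w hw
  by_contra hne
  obtain ⟨s, hs⟩ := cs.exists_rightDescent_of_ne_one hne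
  -- As `s` is a descent of `w`, the element `w s` must send `α_s` to a non-negative vector; if `w`
  -- acts trivially, the image is `-α_s`.
  have h1 := cs.geomRep_simpleRoot_nonneg h (w * cs.simple s) s (by
    simpa [IsRightDescent] using hs)
  rw [map_mul, hw, one_mul, geomRep_simple_simpleRoot_self] at h1
  have := h1 s
  simp [simpleRoot] at this
  linarith

end CoxeterSystem

theorem SimpleGraph.Connected.forall_of_adj {V : Type*} {G : SimpleGraph V} (hG : G.Connected)
    {p : V → Prop} (hp : ∀ u v, G.Adj u v → p u → p v) {u : V} (hu : p u) (v : V) : p v := by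
  have := (SimpleGraph.reachable_iff_reflTransGen u v).1 (hG.preconnected u v)
  induction this with
  | refl => exact hu
  | tail _ hadj ih => exact hp _ _ hadj ih

theorem exists_mul_of_sup_eq_top {G : Type*} [Group G] {H K : Subgroup G}
    (hcomm : ∀ h ∈ H, ∀ k ∈ K, Commute h k) (hsup : H ⊔ K = ⊤) (g : G) :
    ∃ a ∈ H, ∃ b ∈ K, g = a * b := by
  have hc : ∀ (m : H) (n : K), Commute (H.subtype m) (K.subtype n) :=
    fun m n => hcomm m m.2 n n.2
  have hg : g ∈ (MonoidHom.noncommCoprod H.subtype K.subtype hc).range := by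
    rw [MonoidHom.noncommCoprod_range, Subgroup.range_subtype, Subgroup.range_subtype, hsup]
    trivial
  obtain ⟨⟨a, b⟩, hab⟩ := hg
  exact ⟨a, a.2, b, b.2, by simpa using hab.symm⟩

namespace CoxeterMatrix

variable {S : Type*} {M : CoxeterMatrix S}

theorem IsSpherical.adj_iff [Fintype S] [DecidableEq S] (h : M.IsSpherical) {s t : S} :
    M.coxeterGraph.Adj s t ↔ s ≠ t ∧ 3 ≤ M s t := by
  simp [coxeterGraph, h.ne_zero s t]

theorem IsSpherical.three_le [Fintype S] [DecidableEq S] (h : M.IsSpherical) {s t : S}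
    (hst : M.coxeterGraph.Adj s t) : 3 ≤ M s t := (h.adj_iff.1 hst).2

theorem cos_pi_div_mono {m n : ℕ} (hm : 0 < m) (hmn : m ≤ n) : cos (π / m) ≤ cos (π / n) := by
  have hm' : (1 : ℝ) ≤ m := by exact_mod_cast hm
  have hmn' : (m : ℝ) ≤ n := by exact_mod_cast hmn
  have hpi := pi_pos
  apply cos_le_cos_of_nonneg_of_le_pi
  · positivity
  · rw [div_le_iff₀ (by linarith)]; nlinarith
  · gcongr

theorem IsSpherical.canonicalForm_le [Fintype S] [DecidableEq S] (h : M.IsSpherical) {s t : S}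
    {m : ℕ} (hm : 0 < m) (hst : m ≤ M s t) : M.canonicalForm s t ≤ -cos (π / m) := by
  rw [h.canonicalForm_eq]
  exact neg_le_neg (cos_pi_div_mono hm hst)

theorem IsSpherical.canonicalForm_nonpos [Fintype S] [DecidableEq S] (h : M.IsSpherical) {s t : S}
    (hst : s ≠ t) : M.canonicalForm s t ≤ 0 := by
  simpa using h.canonicalForm_le two_pos (h.two_le hst)

theorem IsSpherical.canonicalForm_adj [Fintype S] [DecidableEq S] (h : M.IsSpherical) {s t : S}
    (hst : M.coxeterGraph.Adj s t) : M.canonicalForm s t ≤ -(1 / 2) := by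
  simpa using h.canonicalForm_le (m := 3) (by norm_num) (h.three_le hst)

end CoxeterMatrix

/-! ### The centre, and commuting subgroups that generate the group. -/

namespace CoxeterSystem

open CoxeterMatrix

variable {S : Type*} [Fintype S] [DecidableEq S] {M : CoxeterMatrix S}
  {W : Type*} [Group W] (cs : CoxeterSystem M W) (h : M.IsSpherical)

theorem eq_or_eq_neg_simpleRoot {s : S} {x : S → ℝ} (hx : M.rootForm x x = 1) {c : ℝ}
    (hc : x = c • simpleRoot s) : x = simpleRoot s ∨ x = -simpleRoot s := by
  have : c * c = 1 := by simpa [hc] using hx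
  rcases mul_self_eq_one_iff.1 this with rfl | rfl
  · left; simpa using hc
  · right; simpa using hc

theorem eq_or_eq_neg_of_simpleReflection_eq_neg {s : S} {x : S → ℝ} (hx : M.rootForm x x = 1)
    (hs : M.simpleReflection s x = -x) : x = simpleRoot s ∨ x = -simpleRoot s := by
  refine eq_or_eq_neg_simpleRoot hx (c := M.rootForm (simpleRoot s) x) ?_
  rw [simpleReflection_apply] at hs
  have h2 : (2 : ℝ) • x = (2 : ℝ) • (M.rootForm (simpleRoot s) x • simpleRoot s) := by
    rw [two_smul, smul_smul]
    exact eq_of_sub_eq_zero (by linear_combination (exp := 1) hs)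
  exact smul_right_injective _ two_ne_zero h2

include cs h

theorem geomRep_conj_simple (w : W) (s : S) (x : S → ℝ) :
    cs.geomRep h (w * cs.simple s * w⁻¹) x =
      x - (2 * M.rootForm (cs.geomRep h w (simpleRoot s)) x) • cs.geomRep h w (simpleRoot s) := by
  simp only [map_mul, Module.End.mul_apply, geomRep_simple, simpleReflection_apply, map_sub,
    map_smul, geomRep_self_apply_inv]
  rw [← cs.rootForm_geomRep h w (simpleRoot s), geomRep_self_apply_inv]

theorem rootForm_geomRep_simpleRoot_self (w : W) (s : S) :
    M.rootForm (cs.geomRep h w (simpleRoot s)) (cs.geomRep h w (simpleRoot s)) = 1 := by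
  simp [rootForm_geomRep]

/-- The conjugate `w s w⁻¹` acts as the reflection in the unit vector `w α_s`, and a reflection
determines its unit vector up to sign. -/
theorem commute_simple_iff (w : W) (s : S) : Commute w (cs.simple s) ↔
    cs.geomRep h w (simpleRoot s) = simpleRoot s ∨
      cs.geomRep h w (simpleRoot s) = -simpleRoot s := by
  constructor
  · intro hc
    apply eq_or_eq_neg_of_simpleReflection_eq_neg (cs.rootForm_geomRep_simpleRoot_self h w s)
    rw [← geomRep_simple cs h, ← Module.End.mul_apply, ← map_mul, ← hc.eq, map_mul,
      Module.End.mul_apply, geomRep_simple_simpleRoot_self, map_neg]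
  · intro hc
    have : w * cs.simple s * w⁻¹ = cs.simple s := by
      apply cs.geomRep_injective h
      apply LinearMap.ext
      intro x
      rw [geomRep_conj_simple, geomRep_simple, simpleReflection_apply]
      rcases hc with hc | hc <;> simp [hc]
    exact mul_inv_eq_iff_eq_mul.1 this

theorem not_commute_of_adj {s t : S} (hst : M.coxeterGraph.Adj s t) :
    ¬ Commute (cs.simple s) (cs.simple t) := by
  rw [commute_simple_iff cs h, geomRep_simple, simpleReflection_simpleRoot]
  have hne : s ≠ t := hst.ne
  have hc := h.canonicalForm_adj hst
  rintro (he | he)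
  · have := congrFun he s
    simp [simpleRoot_apply, hne] at this
    linarith
  · have := congrFun he t
    simp [simpleRoot_apply, hne.symm] at this
    linarith

omit h in
theorem mem_center_iff (w : W) : w ∈ Subgroup.center W ↔ ∀ s, Commute w (cs.simple s) := by
  constructor
  · intro hw s
    exact ((Subgroup.mem_center_iff.1 hw) (cs.simple s)).symm
  · intro hw
    rw [Subgroup.mem_center_iff]
    intro g
    induction g using cs.simple_induction with
    | simple s => exact (hw s).eq.symm
    | one => simp
    | mul a b ha hb => rw [mul_assoc, hb, ← mul_assoc, ha, mul_assoc]

/-- Each simple root is fixed or negated. Adjacent roots are not orthogonal, so the sign is the same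
at both ends of an edge; the sign + throughout would give `z = 1` by faithfulness. -/
theorem geomRep_of_mem_center (hconn : M.coxeterGraph.Connected) {z : W}
    (hz : z ∈ Subgroup.center W) (hz1 : z ≠ 1) : cs.geomRep h z = -1 := by
  have hs := fun s => (cs.commute_simple_iff h z s).1 ((cs.mem_center_iff z).1 hz s)
  have hsign : ∀ s t, M.coxeterGraph.Adj s t → cs.geomRep h z (simpleRoot s) = simpleRoot s →
      cs.geomRep h z (simpleRoot t) = simpleRoot t := by
    intro s t hst hα
    refine (hs t).resolve_right fun hβ => ?_
    have := cs.rootForm_geomRep h z (simpleRoot s) (simpleRoot t)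
    rw [hα, hβ, map_neg, rootForm_simpleRoot] at this
    linarith [h.canonicalForm_adj hst]
  have hsign' : ∀ s t, M.coxeterGraph.Adj s t → cs.geomRep h z (simpleRoot s) = -simpleRoot s →
      cs.geomRep h z (simpleRoot t) = -simpleRoot t := by
    intro s t hst hα
    refine (hs t).resolve_left fun hβ => ?_
    have := hsign t s hst.symm hβ
    rw [this] at hα
    exact simpleRoot_ne_zero s (self_eq_neg.1 hα)
  obtain ⟨s₀⟩ := hconn.nonempty
  have hext : ∀ f : Module.End ℝ (S → ℝ), (∀ s, cs.geomRep h z (simpleRoot s) = f (simpleRoot s)) →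
      cs.geomRep h z = f := by
    intro f hf
    apply LinearMap.pi_ext'
    intro s
    ext1
    simpa [simpleRoot] using hf s
  rcases hs s₀ with h0 | h0
  · exfalso
    apply hz1
    apply cs.geomRep_injective h
    rw [map_one]
    exact hext _ fun s => hconn.forall_of_adj hsign h0 s
  · exact hext _ fun s => by simpa using hconn.forall_of_adj hsign' h0 s

theorem mem_center_of_geomRep {z : W} (hz : cs.geomRep h z = -1) : z ∈ Subgroup.center W := by
  rw [cs.mem_center_iff]
  intro s
  rw [cs.commute_simple_iff h, hz]
  simp

theorem eq_of_mem_center (hconn : M.coxeterGraph.Connected) {y z : W}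
    (hy : y ∈ Subgroup.center W) (hy1 : y ≠ 1) (hz : z ∈ Subgroup.center W) (hz1 : z ≠ 1) :
    y = z :=
  cs.geomRep_injective h (by
    rw [cs.geomRep_of_mem_center h hconn hy hy1, cs.geomRep_of_mem_center h hconn hz hz1])

/-- In a direct decomposition, no simple reflection fails to commute with both factors; case where
the first component fixes the simple root. -/
theorem false_of_not_commute {H K : Subgroup W} (hcomm : ∀ x ∈ H, ∀ y ∈ K, Commute x y) {s : S}
    {a b x k : W} (ha : a ∈ H) (hb : b ∈ K) (hab : cs.simple s = a * b)
    (haα : cs.geomRep h a (simpleRoot s) = simpleRoot s)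
    (hbα : cs.geomRep h b (simpleRoot s) = -simpleRoot s)
    (hx : x ∈ H) (hxs : ¬ Commute x (cs.simple s)) (hk : k ∈ K) (hks : ¬ Commute k (cs.simple s)) :
    False := by
  -- The plane of `α` and `β = x α` is the image of `r - 1` for a rotation `r` in `H`, so `K`
  -- preserves it, and `b` is -1 on it. Hence `a` fixes and `b` negates `k⁻¹ α`, so `s` negates it;
  -- this forces `k⁻¹ α = ±α`, that is, `k` commutes with `s`.
  set ρ := cs.geomRep h with hρ
  set α : S → ℝ := simpleRoot s with hα
  set β := ρ x α with hβ
  have swap : ∀ {u v : W}, Commute u v → ∀ y, ρ u (ρ v y) = ρ v (ρ u y) := by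
    intro u v huv y
    rw [← Module.End.mul_apply, ← Module.End.mul_apply, ← map_mul, ← map_mul, huv.eq]
  have hbβ : ρ b β = -β := by
    rw [hβ, swap (hcomm x hx b hb).symm, hbα, map_neg]
  set c := M.rootForm α β with hc
  have hαα : M.rootForm α α = 1 := by simp [hα]
  have hββ : M.rootForm β β = 1 := cs.rootForm_geomRep_simpleRoot_self h x s
  have hβα : M.rootForm β α = c := M.rootForm_comm _ _
  have hc1 : 1 - c ^ 2 ≠ 0 := by
    intro hc0
    have hne : β - c • α ≠ 0 := fun h0 =>
      hxs ((cs.commute_simple_iff h x s).2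
        (eq_or_eq_neg_simpleRoot hββ (sub_eq_zero.1 h0)))
    have := h.rootForm_pos hne
    simp only [map_sub, map_smul, LinearMap.sub_apply, LinearMap.smul_apply, hαα, hββ, hβα, ← hc,
      smul_eq_mul] at this
    nlinarith
  -- the rotation `r = x s x⁻¹ s` belongs to `H`
  set r := x * cs.simple s * x⁻¹ * cs.simple s with hr
  have hrH : r ∈ H := by
    -- Since `b` commutes with `x`, it cancels and a commutator inside `H` remains.
    have : r = x * a * x⁻¹ * a⁻¹ := by
      have h1 : cs.simple s = b⁻¹ * a⁻¹ := by rw [← mul_inv_rev, ← hab, inv_simple]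
      have h2 : b * x⁻¹ = x⁻¹ * b := ((hcomm x⁻¹ (H.inv_mem hx) b hb).eq).symm
      calc r = x * (a * b) * x⁻¹ * (b⁻¹ * a⁻¹) := by rw [hr, ← h1, ← hab]
        _ = x * a * (b * x⁻¹) * (b⁻¹ * a⁻¹) := by group
        _ = _ := by rw [h2]; group
    rw [this]
    exact H.mul_mem (H.mul_mem (H.mul_mem hx ha) (H.inv_mem hx)) (H.inv_mem ha)
  have hrapp : ∀ y, ρ r y = y - (2 * M.rootForm α y) • α -
      (2 * (M.rootForm β y - 2 * M.rootForm α y * c)) • β := by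
    intro y
    rw [hr, map_mul, Module.End.mul_apply, hρ, geomRep_conj_simple, geomRep_simple,
      simpleReflection_apply, ← hρ, ← hα, ← hβ, map_sub, map_smul, hβα, smul_eq_mul]
  have hspan : ∀ k ∈ K, ∃ p q : ℝ, ρ k α = p • α + q • β := by
    intro k hk
    -- `y` is the solution in the plane of `r y - y = α`, found by prescribing its products with `α`
    -- and `β`.
    set y : S → ℝ := ((c ^ 2 - 1 / 2) / (1 - c ^ 2)) • α + ((-c / 2) / (1 - c ^ 2)) • β with hy
    have h1 : M.rootForm α y = -(1 / 2) := by
      simp only [hy, map_add, map_smul, hαα, ← hc, smul_eq_mul]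
      field_simp; ring
    have h2 : M.rootForm β y = -c := by
      simp only [hy, map_add, map_smul, hββ, hβα, smul_eq_mul]
      field_simp; ring
    have h3 : ρ r y = y + α := by
      rw [hrapp, h1, h2]; module
    have h4 : ρ k α = ρ r (ρ k y) - ρ k y := by
      rw [swap (hcomm r hrH k hk), h3, map_add]; abel
    rw [hrapp] at h4
    refine ⟨-(2 * M.rootForm α (ρ k y)),
      -(2 * (M.rootForm β (ρ k y) - 2 * M.rootForm α (ρ k y) * c)), h4.trans ?_⟩
    module
  obtain ⟨p, q, hpq⟩ := hspan k⁻¹ (K.inv_mem hk)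
  have h5 : ρ b (ρ k⁻¹ α) = -ρ k⁻¹ α := by
    rw [hpq, map_add, map_smul, map_smul, hbα, hbβ]; module
  have h6 : ρ a (ρ k⁻¹ α) = ρ k⁻¹ α := by
    rw [swap (hcomm a ha _ (K.inv_mem hk)), haα]
  have h7 : M.simpleReflection s (ρ k⁻¹ α) = -ρ k⁻¹ α := by
    rw [← geomRep_simple cs h, hab, map_mul, Module.End.mul_apply, ← hρ, h5, map_neg, h6]
  have h8 : Commute k⁻¹ (cs.simple s) := (cs.commute_simple_iff h _ s).2
    (eq_or_eq_neg_of_simpleReflection_eq_neg (cs.rootForm_geomRep_simpleRoot_self h k⁻¹ s) h7)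
  exact hks (Commute.inv_left_iff.1 h8)

/-- Both components of `s = a b` commute with `s`, so each acts on `α_s` by a sign; the product of
the signs is -1, and the two remaining cases are exchanged by swapping the factors. -/
theorem forall_commute_or {H K : Subgroup W} (hcomm : ∀ x ∈ H, ∀ y ∈ K, Commute x y)
    (hsup : H ⊔ K = ⊤) (s : S) :
    (∀ x ∈ H, Commute x (cs.simple s)) ∨ (∀ y ∈ K, Commute y (cs.simple s)) := by
  by_contra hcon
  push Not at hcon
  obtain ⟨⟨x, hx, hxs⟩, ⟨k, hk, hks⟩⟩ := hcon
  obtain ⟨a, ha, b, hb, hab⟩ := exists_mul_of_sup_eq_top hcomm hsup (cs.simple s)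
  have hab' : Commute a b := hcomm a ha b hb
  have has : Commute a (cs.simple s) := by
    rw [hab]; exact (Commute.refl a).mul_right hab'
  have hα : cs.geomRep h a (cs.geomRep h b (simpleRoot s)) = -simpleRoot s := by
    rw [← Module.End.mul_apply, ← map_mul, ← hab, geomRep_simple_simpleRoot_self]
  have hbs : Commute b (cs.simple s) := by
    rw [hab]; exact hab'.symm.mul_right (Commute.refl b)
  rcases (cs.commute_simple_iff h a s).1 has with h1 | h1 <;>
  rcases (cs.commute_simple_iff h b s).1 hbs with h2 | h2
  · rw [h2, h1] at hα
    exact simpleRoot_ne_zero s (self_eq_neg.1 hα)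
  · exact cs.false_of_not_commute h hcomm ha hb hab h1 h2 hx hxs hk hks
  · exact cs.false_of_not_commute h (fun y hy x hx => (hcomm x hx y hy).symm) hb ha
      (hab.trans hab'.eq) h2 h1 hk hks hx hxs
  · rw [h2, map_neg, h1, neg_neg] at hα
    exact simpleRoot_ne_zero s (self_eq_neg.1 hα)

/-- In a direct decomposition of an irreducible Coxeter group of spherical type, one of the factors
is central. -/
theorem le_center_or_le_center (hconn : M.coxeterGraph.Connected) {H K : Subgroup W}
    (hcomm : ∀ x ∈ H, ∀ y ∈ K, Commute x y) (hsup : H ⊔ K = ⊤) :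
    H ≤ Subgroup.center W ∨ K ≤ Subgroup.center W := by
  choose a ha b hb hab using fun s => exists_mul_of_sup_eq_top hcomm hsup (cs.simple s)
  -- If `H` commutes with `s = a s * b s`, then `a t` commutes with `a s`, because it commutes with
  -- `b s` already; so `a s` is central.
  have hcent : ∀ s, (∀ t, Commute (a s) (cs.simple t)) ∨ (∀ t, Commute (b s) (cs.simple t)) := by
    intro s
    rcases cs.forall_commute_or h hcomm hsup s with hs | hs
    · left
      intro t
      rw [hab t]
      refine Commute.mul_right ?_ (hcomm _ (ha s) _ (hb t))
      have h1 : a t * (a s * b s) = (a s * b s) * a t := by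
        have := (hs _ (ha t)).eq
        rwa [hab s] at this
      rw [mul_assoc, ← (hcomm _ (ha t) _ (hb s)).eq, ← mul_assoc, ← mul_assoc] at h1
      exact (mul_right_cancel h1).symm
    · right
      intro t
      rw [hab t]
      refine Commute.mul_right (hcomm _ (ha t) _ (hb s)).symm ?_
      have h1 : b t * (a s * b s) = (a s * b s) * b t := by
        have := (hs _ (hb t)).eq
        rwa [hab s] at this
      rw [← mul_assoc, ← (hcomm _ (ha s) _ (hb t)).eq, mul_assoc, mul_assoc] at h1
      exact (mul_left_cancel h1).symm
  -- If `a s` and `b t` were both central, then `s` and `t` would commute.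
  have hprop : ∀ s t, M.coxeterGraph.Adj s t → (∀ u, Commute (a s) (cs.simple u)) →
      ∀ u, Commute (a t) (cs.simple u) := by
    intro s t hst hs
    refine (hcent t).resolve_right fun ht => cs.not_commute_of_adj h hst ?_
    rw [hab s]
    refine Commute.mul_left (hs t) ?_
    rw [hab t]
    refine Commute.mul_right (hcomm _ (ha t) _ (hb s)).symm ?_
    have := ht s
    rw [hab s] at this
    have h2 : Commute (b t) ((a s)⁻¹ * (a s * b s)) :=
      ((hcomm _ (ha s) _ (hb t)).symm.inv_right).mul_right this
    rw [inv_mul_cancel_left] at h2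
    exact h2.symm
  by_cases hex : ∃ s, ∀ u, Commute (a s) (cs.simple u)
  · left
    obtain ⟨s₀, hs₀⟩ := hex
    intro x hx
    rw [cs.mem_center_iff]
    intro s
    have hs := (cs.mem_center_iff (a s)).2 (hconn.forall_of_adj hprop hs₀ s)
    rw [hab s]
    exact Commute.mul_right (Subgroup.mem_center_iff.1 hs x) (hcomm x hx _ (hb s))
  · right
    push Not at hex
    intro y hy
    rw [cs.mem_center_iff]
    intro s
    have hs := (cs.mem_center_iff (b s)).2 ((hcent s).resolve_left fun hs => by
      obtain ⟨u, hu⟩ := hex s; exact hu (hs u))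
    rw [hab s]
    exact Commute.mul_right (hcomm _ (ha s) y hy).symm (Subgroup.mem_center_iff.1 hs y)

end CoxeterSystem

/-! ### Commuting subgroups and complements of the centre. -/

namespace Subgroup

variable {G : Type*} [Group G]

theorem commute_iSup {ι : Sort*} {H : Subgroup G} {K : ι → Subgroup G}
    (hc : ∀ i, ∀ x ∈ H, ∀ y ∈ K i, Commute x y) {x y : G} (hx : x ∈ H) (hy : y ∈ ⨆ i, K i) :
    Commute x y := by
  have : ⨆ i, K i ≤ centralizer (H : Set G) :=
    iSup_le fun i y hy => mem_centralizer_iff.2 fun x hx => (hc i x hx y hy).eq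
  exact mem_centralizer_iff.1 (this hy) x hx

theorem commute_sup {H K L : Subgroup G} (hK : ∀ x ∈ H, ∀ y ∈ K, Commute x y)
    (hL : ∀ x ∈ H, ∀ y ∈ L, Commute x y) {x y : G} (hx : x ∈ H) (hy : y ∈ K ⊔ L) :
    Commute x y := by
  have : K ⊔ L ≤ centralizer (H : Set G) :=
    sup_le (fun y hy => mem_centralizer_iff.2 fun x hx => (hK x hx y hy).eq)
      (fun y hy => mem_centralizer_iff.2 fun x hx => (hL x hx y hy).eq)
  exact mem_centralizer_iff.1 (this hy) x hx

theorem commute_of_mem_center {x y : G} (hx : x ∈ center G) : Commute x y :=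
  (mem_center_iff.1 hx y).symm

/-- A complement of the centre is isomorphic to the central quotient. -/
theorem nonempty_mulEquiv_quotient_center {K : Subgroup G} (hK : IsCompl (center G) K) :
    Nonempty (K ≃* G ⧸ center G) := by
  refine ⟨MulEquiv.ofBijective ((QuotientGroup.mk' (center G)).comp K.subtype) ⟨?_, ?_⟩⟩
  · rw [injective_iff_map_eq_one]
    intro x hx
    have hx' : (x : G) ∈ center G := by simpa using hx
    have := hK.disjoint.le_bot ⟨hx', x.2⟩
    exact Subtype.ext (mem_bot.1 this)
  · intro g
    obtain ⟨g, rfl⟩ := QuotientGroup.mk'_surjective _ g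
    obtain ⟨z, hz, k, hk, rfl⟩ := exists_mul_of_sup_eq_top
      (fun x hx y _ => commute_of_mem_center hx) hK.sup_eq_top g
    refine ⟨⟨k, hk⟩, ?_⟩
    have hz1 : QuotientGroup.mk' (center G) z = 1 := by simpa using hz
    rw [map_mul, hz1, one_mul]
    rfl

end Subgroup

theorem IsIndecomposableGroup.of_mulEquiv {G H : Type*} [Group G] [Group H] (e : G ≃* H)
    (hG : IsIndecomposableGroup G) : IsIndecomposableGroup H := by
  rintro L ⟨L', hL, hc⟩
  have hcompl : IsCompl (L.map e.symm.toMonoidHom) (L'.map e.symm.toMonoidHom) :=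
    (e.symm.mapSubgroup).isCompl hL
  have := hG (L.map e.symm.toMonoidHom) ⟨L'.map e.symm.toMonoidHom, hcompl, by
    rintro _ ⟨x, hx, rfl⟩ _ ⟨y, hy, rfl⟩
    exact (hc x hx y hy).map e.symm.toMonoidHom⟩
  rcases this with h | h
  · left
    exact (e.symm.mapSubgroup).injective (h.trans (map_bot (e.symm.mapSubgroup)).symm)
  · right
    exact (e.symm.mapSubgroup).injective (h.trans (map_top (e.symm.mapSubgroup)).symm)

/-! ### Groups with centre of order at most two and a central factor in every decomposition. -/

section CentralFactor

open Subgroup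

variable {W : Type*} [Group W]
  (hdir : ∀ H K : Subgroup W, (∀ x ∈ H, ∀ y ∈ K, Commute x y) → H ⊔ K = ⊤ →
    H ≤ center W ∨ K ≤ center W)
  (hcen : ∀ y ∈ center W, y ≠ 1 → ∀ z ∈ center W, z ≠ 1 → y = z)

include hcen in
theorem eq_bot_or_eq_center {H : Subgroup W} (hH : H ≤ center W) : H = ⊥ ∨ H = center W := by
  by_cases hb : H = ⊥
  · exact Or.inl hb
  right
  obtain ⟨x, hx, hx1⟩ := H.bot_or_exists_ne_one.resolve_left hb
  refine le_antisymm hH fun z hz => ?_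
  by_cases hz1 : z = 1
  · rw [hz1]; exact H.one_mem
  · rw [hcen z hz hz1 x (hH hx) hx1]; exact hx

include hdir hcen in
theorem exists_isCompl_center (hW : IsDecomposableGroup W) :
    ∃ K : Subgroup W, IsCompl (center W) K ∧ center W ≠ ⊥ ∧ K ≠ ⊥ := by
  simp only [IsDecomposableGroup, IsIndecomposableGroup, not_forall, not_or] at hW
  obtain ⟨H, ⟨K, hHK, hc⟩, hb, ht⟩ := hW
  have hKb : K ≠ ⊥ := by
    rintro rfl
    exact ht (by simpa using hHK.sup_eq_top)
  rcases hdir H K hc hHK.sup_eq_top with h | h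
  · have := (eq_bot_or_eq_center hcen h).resolve_left hb
    subst this
    exact ⟨K, hHK, hb, hKb⟩
  · have := (eq_bot_or_eq_center hcen h).resolve_left hKb
    subst this
    exact ⟨H, hHK.symm, hKb, hb⟩

include hcen in
theorem isIndecomposableGroup_center : IsIndecomposableGroup (center W) := by
  intro L _
  have hle : L.map (center W).subtype ≤ center W := map_subtype_le L
  rcases eq_bot_or_eq_center hcen hle with h | h
  · left
    rwa [map_eq_bot_iff_of_injective _ (subtype_injective _)] at h
  · right
    apply map_injective (subtype_injective (center W))
    rw [h, ← MonoidHom.range_eq_map, range_subtype]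

include hdir in
-- If `K = L × L'`, then `L` and `L' ⊔ center W` commute and generate `W`, so `L` or `L'` is
-- central; a central subgroup of `K` is trivial.
theorem isIndecomposableGroup_of_isCompl_center {K : Subgroup W} (hK : IsCompl (center W) K) :
    IsIndecomposableGroup K := by
  rintro L ⟨L', hL, hc⟩
  have hsup : L.map K.subtype ⊔ L'.map K.subtype = K := by
    rw [← Subgroup.map_sup, hL.sup_eq_top, ← MonoidHom.range_eq_map, range_subtype]
  have hbot : ∀ L : Subgroup K, L.map K.subtype ≤ center W → L = ⊥ := by
    intro L hL
    have : L.map K.subtype ≤ ⊥ := hK.disjoint hL (map_subtype_le L)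
    rwa [le_bot_iff, map_eq_bot_iff_of_injective _ (subtype_injective _)] at this
  rcases hdir (L.map K.subtype) (L'.map K.subtype ⊔ center W) (fun x hx y hy => by
      refine commute_sup (H := L.map K.subtype) ?_ ?_ hx hy
      · rintro _ ⟨x, hx, rfl⟩ _ ⟨y, hy, rfl⟩
        exact (hc x hx y hy).map K.subtype
      · exact fun x _ y hy => (commute_of_mem_center hy).symm)
    (by rw [← sup_assoc, hsup, sup_comm, hK.sup_eq_top]) with h | h
  · exact Or.inl (hbot L h)
  · right
    have := hbot L' (le_sup_left.trans h)
    subst this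
    simpa using hL.sup_eq_top

include hdir hcen in
theorem exists_isRemakDecomposition_center (hW : IsDecomposableGroup W) :
    ∃ H : Fin 2 → Subgroup W, IsRemakDecomposition H ∧
      Nonempty (H 0 ≃* center W) ∧ Nonempty (H 1 ≃* W ⧸ center W) := by
  obtain ⟨K, hK, hZ, hKb⟩ := exists_isCompl_center hdir hcen hW
  refine ⟨![center W, K], ⟨?_, ?_, ?_, ?_, ?_⟩, ⟨MulEquiv.refl _⟩,
    nonempty_mulEquiv_quotient_center hK⟩
  · intro i j hij x hx y hy
    fin_cases i <;> fin_cases j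
    · exact absurd rfl hij
    · exact commute_of_mem_center hx
    · exact (commute_of_mem_center hy).symm
    · exact absurd rfl hij
  · rw [iSupIndep_pair (i := 0) (j := 1) (by decide) (by intro k; fin_cases k <;> simp)]
    exact hK.disjoint
  · rw [eq_top_iff, ← hK.sup_eq_top]
    exact sup_le (le_iSup ![center W, K] 0) (le_iSup ![center W, K] 1)
  · intro i
    fin_cases i
    · exact (nontrivial_iff_ne_bot _).2 hZ
    · exact (nontrivial_iff_ne_bot _).2 hKb
  · intro i
    fin_cases i
    · exact isIndecomposableGroup_center hcen
    · exact isIndecomposableGroup_of_isCompl_center hdir hK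

include hdir hcen in
-- Compare each factor with the product of the others: one side is central. A central factor is the
-- whole centre, so there is at most one such. A single factor would be `W`, which is decomposable,
-- and a third factor would be a second central one.
theorem IsRemakDecomposition.eq_two (hW : IsDecomposableGroup W) {q : ℕ} {H : Fin q → Subgroup W}
    (hH : IsRemakDecomposition H) :
    q = 2 ∧ ∃ i j : Fin q, i ≠ j ∧
      Nonempty (H i ≃* center W) ∧ Nonempty (H j ≃* W ⧸ center W) := by
  have hle : ∀ {i j}, j ≠ i → H j ≤ ⨆ (j) (_ : j ≠ i), H j := fun {i j} hij =>
    le_iSup₂ (f := fun j (_ : j ≠ i) => H j) j hij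
  have hsplit : ∀ i, H i ≤ center W ∨ ⨆ (j) (_ : j ≠ i), H j ≤ center W := by
    intro i
    refine hdir _ _ (fun x hx y hy => ?_) ?_
    · refine commute_iSup (H := H i) (fun j x hx y hy => ?_) hx hy
      exact commute_iSup (H := H i) (fun hj x hx y hy => hH.commute i j hj.symm x hx y hy) hx hy
    · rw [eq_top_iff, ← hH.generate]
      refine iSup_le fun j => ?_
      by_cases hj : j = i
      · rw [hj]; exact le_sup_left
      · exact (hle hj).trans le_sup_right
  have hne : ∀ i, H i ≠ ⊥ := fun i => (nontrivial_iff_ne_bot _).1 (hH.nontrivial i)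
  have heq : ∀ i, H i ≤ center W → H i = center W := fun i hi =>
    (eq_bot_or_eq_center hcen hi).resolve_left (hne i)
  have hdisj : ∀ i j, i ≠ j → Disjoint (H i) (H j) := fun i j hij =>
    (hH.independent i).mono_right (hle hij.symm)
  have huniq : ∀ i j, H i ≤ center W → H j ≤ center W → i = j := by
    intro i j hi hj
    by_contra hij
    have := hdisj i j hij
    rw [heq i hi, heq j hj, disjoint_self] at this
    exact hne i ((heq i hi).trans this)
  have h2 : ∃ a b : Fin q, a ≠ b := by
    by_contra hcon
    push Not at hcon
    have hWd := hW
    obtain ⟨K, hK, hZ, hKb⟩ := exists_isCompl_center hdir hcen hW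
    rcases isEmpty_or_nonempty (Fin q) with he | ⟨⟨i⟩⟩
    · have := hH.generate
      rw [iSup_of_empty] at this
      exact hZ (eq_bot_iff.2 (this ▸ le_top))
    · have htop : H i = ⊤ := by
        rw [eq_top_iff, ← hH.generate]
        exact iSup_le fun j => (congrArg H (hcon j i)).le
      exact hWd ((hH.indecomposable i).of_mulEquiv
        ((MulEquiv.subgroupCongr htop).trans topEquiv))
  obtain ⟨i, hi⟩ : ∃ i, H i ≤ center W := by
    obtain ⟨a, b, hab⟩ := h2
    rcases hsplit a with h | h
    · exact ⟨a, h⟩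
    · exact ⟨b, (hle hab.symm).trans h⟩
  obtain ⟨j, hij⟩ : ∃ j, i ≠ j := by
    obtain ⟨a, b, hab⟩ := h2
    by_cases h : i = a
    · exact ⟨b, h ▸ hab⟩
    · exact ⟨a, h⟩
  have hall : ∀ k, k = i ∨ k = j := by
    intro k
    by_contra hk
    push Not at hk
    have hj := (hsplit j).resolve_left fun hj => hij (huniq i j hi hj)
    exact hk.1 (huniq k i ((hle hk.2).trans hj) hi)
  have hcard : q = 2 := by
    have : (Finset.univ : Finset (Fin q)) = {i, j} := by
      ext k; simpa using hall k
    have h3 := congrArg Finset.card this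
    rwa [Finset.card_univ, Fintype.card_fin, Finset.card_pair hij] at h3
  refine ⟨hcard, i, j, hij, ⟨MulEquiv.subgroupCongr (heq i hi)⟩, ?_⟩
  apply nonempty_mulEquiv_quotient_center
  rw [← heq i hi]
  refine ⟨hdisj i j hij, codisjoint_iff.2 ?_⟩
  rw [eq_top_iff, ← hH.generate]
  refine iSup_le fun k => ?_
  rcases hall k with rfl | rfl
  · exact le_sup_left
  · exact le_sup_right

include hdir hcen in
/-- Decomposability in terms of a linear character that is non-trivial on the centre. -/
theorem isDecomposableGroup_iff (hne : center W ≠ ⊤) : IsDecomposableGroup W ↔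
    ∃ z ∈ center W, ∃ φ : W →* ℤˣ, φ z = -1 := by
  constructor
  · intro hW
    obtain ⟨K, hK, hZ, -⟩ := exists_isCompl_center hdir hcen hW
    obtain ⟨z, hz, hz1⟩ := (center W).bot_or_exists_ne_one.resolve_left hZ
    have hdec : ∀ w : W, w ∈ K ∨ z * w ∈ K := by
      intro w
      obtain ⟨y, hy, k, hk, rfl⟩ := exists_mul_of_sup_eq_top
        (fun x hx y _ => commute_of_mem_center hx) hK.sup_eq_top w
      by_cases hy1 : y = 1
      · left; simpa [hy1] using hk
      · right
        have hyz := hcen y hy hy1 z hz hz1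
        have hzz : z * z = 1 := by
          have := hcen z⁻¹ (inv_mem hz) (inv_ne_one.2 hz1) z hz hz1
          exact inv_eq_iff_mul_eq_one.1 this
        rw [hyz, ← mul_assoc, hzz, one_mul]
        exact hk
    have hzK : z ∉ K := fun h => hz1 (mem_bot.1 (hK.disjoint.le_bot ⟨hz, h⟩))
    -- The centre is {1, z}, so its complement has index two and defines the character.
    have hindex : K.index = 2 := by
      rw [index_eq_two_iff]
      refine ⟨z, fun w => ?_⟩
      have hcomm : w * z = z * w := (mem_center_iff.1 hz w)
      rw [hcomm]
      rcases hdec w with h | h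
      · exact Or.inr ⟨h, fun h' => hzK (by simpa using K.mul_mem h' (K.inv_mem h))⟩
      · exact Or.inl ⟨h, fun h' => hzK (by simpa using K.mul_mem h (K.inv_mem h'))⟩
    classical
    refine ⟨z, hz, MonoidHom.mk' (fun w => if w ∈ K then 1 else -1) fun x y => ?_, ?_⟩
    · have := mul_mem_iff_of_index_two hindex (a := x) (b := y)
      by_cases hx : x ∈ K <;> by_cases hy : y ∈ K <;> simp [hx, hy, this]
    · simp [hzK]
  · rintro ⟨z, hz, φ, hφ⟩ hind
    have hz1 : z ≠ 1 := by
      rintro rfl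
      rw [map_one] at hφ
      exact absurd hφ (by decide)
    -- The kernel of `φ` is a complement of the centre, and `hne` makes the centre a proper factor.
    refine absurd (hind (center W) ⟨φ.ker, ⟨?_, ?_⟩, fun x hx y _ => commute_of_mem_center hx⟩)
      (not_or.2 ⟨fun hb => hz1 ?_, hne⟩)
    · rw [disjoint_iff_inf_le]
      rintro y ⟨hy, hyφ⟩
      rw [mem_bot]
      by_contra hy1
      rw [hcen y hy hy1 z hz hz1] at hyφ
      have : φ z = 1 := hyφ
      rw [hφ] at this
      exact absurd this (by decide)
    · rw [codisjoint_iff_le_sup]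
      intro w _
      rcases Int.units_eq_one_or (φ w) with h | h
      · exact mem_sup_right h
      · rw [← mul_inv_cancel_left z w]
        refine mul_mem_sup hz ?_
        rw [MonoidHom.mem_ker, map_mul, map_inv, hφ, h]
        decide
    · rw [hb] at hz
      exact mem_bot.1 hz

end CentralFactor

/-! ### Test vectors for positive definiteness. -/

namespace CoxeterMatrix

section Body

variable {S : Type*} [Fintype S] [DecidableEq S] {M : CoxeterMatrix S}

/-- There is a non-negative vector with support in `T`, equal to `1` on `C`, whose norm is at
most `N`. -/
def HasBody (M : CoxeterMatrix S) (C T : Set S) (N : ℝ) : Prop :=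
  ∃ β : S → ℝ, (∀ s, 0 ≤ β s) ∧ (∀ s, s ∉ T → β s = 0) ∧ (∀ s ∈ C, β s = 1) ∧ M.rootForm β β ≤ N

/-- Every forbidden diagram is excluded here: it carries a body with bound `N ≤ 0`. -/
theorem HasBody.pos (h : M.IsSpherical) {C T : Set S} {N : ℝ} (hb : M.HasBody C T N)
    (hC : C.Nonempty) : 0 < N := by
  obtain ⟨β, -, -, h1, hN⟩ := hb
  obtain ⟨s, hs⟩ := hC
  refine (h.rootForm_pos (x := β) fun h0 => ?_).trans_le hN
  have := h1 s hs
  rw [h0] at this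
  simp at this

theorem hasBody_singleton (s : S) : M.HasBody {s} {s} 1 := by
  refine ⟨simpleRoot s, fun t => ?_, fun t ht => ?_, fun t ht => ?_, by simp⟩
  · rw [simpleRoot_apply]; split_ifs <;> norm_num
  · rw [simpleRoot_apply, if_neg (by simpa using ht)]
  · rw [simpleRoot_apply, if_pos (by simpa using ht)]

/-- Between disjoint supports all terms of the form are non-positive, so all except those joining
`D` to `y` may be dropped. -/
theorem IsSpherical.rootForm_le (h : M.IsSpherical) {β w : S → ℝ} {T T' : Set S}
    (hβ : ∀ s, 0 ≤ β s) (hw : ∀ s, 0 ≤ w s) (hβT : ∀ s, s ∉ T → β s = 0)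
    (hwT : ∀ s, s ∉ T' → w s = 0) (hT : Disjoint T T') (D : Finset S) (y : S)
    (hD : ∀ s ∈ D, β s = 1) (hy : w y = 1) :
    M.rootForm β w ≤ ∑ s ∈ D, M.canonicalForm s y := by
  have hterm : ∀ s t, β s * M.canonicalForm s t * w t ≤ 0 := by
    intro s t
    by_cases hs : s ∈ T
    · by_cases ht : t ∈ T'
      · have hst : s ≠ t := fun hst => Set.disjoint_left.1 hT hs (hst ▸ ht)
        exact mul_nonpos_of_nonpos_of_nonneg
          (mul_nonpos_of_nonneg_of_nonpos (hβ s) (h.canonicalForm_nonpos hst)) (hw t)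
      · simp [hwT t ht]
    · simp [hβT s hs]
  rw [rootForm_apply]
  calc ∑ s, ∑ t, β s * M.canonicalForm s t * w t
      ≤ ∑ s ∈ D, ∑ t, β s * M.canonicalForm s t * w t := by
        rw [← Finset.sum_sdiff (Finset.subset_univ D)]
        exact add_le_of_nonpos_left
          (Finset.sum_nonpos fun s _ => Finset.sum_nonpos fun t _ => hterm s t)
    _ ≤ ∑ s ∈ D, M.canonicalForm s y := by
        refine Finset.sum_le_sum fun s hs => ?_
        rw [← Finset.sum_erase_add _ _ (Finset.mem_univ y), hD s hs, hy]
        have : ∑ t ∈ Finset.univ.erase y, 1 * M.canonicalForm s t * w t ≤ 0 :=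
          Finset.sum_nonpos fun t _ => by simpa [hD s hs] using hterm s t
        linarith

/-- Attach an arm with tip `y` to a body. -/
theorem HasBody.attach (h : M.IsSpherical) {C T T' : Set S} {N N' k : ℝ} {y : S}
    (hb : M.HasBody C T N) (ha : M.HasBody {y} T' N') (hT : Disjoint T T') (hCT : C ⊆ T)
    (D : Finset S) (hDC : ∀ s ∈ D, s ∈ C) (hk : 0 ≤ k)
    (hD : ∑ s ∈ D, M.canonicalForm s y ≤ -k) :
    M.HasBody C (T ∪ T') (N - k ^ 2 / N') := by
  have hN' := ha.pos h (Set.singleton_nonempty y)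
  obtain ⟨β, hβ, hβT, hβC, hβN⟩ := hb
  obtain ⟨w, hw, hwT, hwy, hwN⟩ := ha
  -- The factor λ = k / N' minimises the bound N - 2kλ + N'λ².
  refine ⟨β + (k / N') • w, fun s => ?_, fun s hs => ?_, fun s hs => ?_, ?_⟩
  · have := hβ s; have := hw s
    simp only [Pi.add_apply, Pi.smul_apply, smul_eq_mul]
    positivity
  · rw [Set.mem_union, not_or] at hs
    simp [hβT s hs.1, hwT s hs.2]
  · simp [hβC s hs, hwT s (Set.disjoint_left.1 hT (hCT hs))]
  · have hβw := (h.rootForm_le hβ hw hβT hwT hT D y (fun s hs => hβC s (hDC s hs))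
      (hwy y rfl)).trans hD
    simp only [map_add, map_smul, LinearMap.add_apply, LinearMap.smul_apply, smul_eq_mul,
      M.rootForm_comm w β]
    have h1 : k / N' * M.rootForm β w ≤ k / N' * (-k) :=
      mul_le_mul_of_nonneg_left hβw (by positivity)
    have h2 : k / N' * (k / N' * M.rootForm w w) ≤ k / N' * (k / N' * N') := by gcongr
    have h3 : k / N' * (k / N' * N') = k ^ 2 / N' := by field_simp
    have h4 : k / N' * (-k) = -(k ^ 2 / N') := by ring
    linarith

theorem HasBody.attach_one (h : M.IsSpherical) {C T T' : Set S} {N N' k : ℝ} {y : S}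
    (hb : M.HasBody C T N) (ha : M.HasBody {y} T' N') (hT : Disjoint T T') (hCT : C ⊆ T)
    {c : S} (hc : c ∈ C) (hk : 0 ≤ k) (hD : M.canonicalForm c y ≤ -k) :
    M.HasBody C (T ∪ T') (N - k ^ 2 / N') :=
  hb.attach h ha hT hCT {c} (by simpa using hc) hk (by simpa using hD)

theorem HasBody.leaf (h : M.IsSpherical) {C T : Set S} {N k : ℝ} {y : S}
    (hb : M.HasBody C T N) (hy : y ∉ T) (hCT : C ⊆ T)
    {c : S} (hc : c ∈ C) (hk : 0 ≤ k) (hD : M.canonicalForm c y ≤ -k) :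
    M.HasBody C (insert y T) (N - k ^ 2) := by
  have := hb.attach_one h (hasBody_singleton y) (by simpa using hy) hCT hc hk hD
  rwa [div_one, Set.union_singleton] at this

/-- Adding an adjacent vertex to the centre of a body does not increase its norm. -/
theorem HasBody.grow (h : M.IsSpherical) {C T : Set S} {N : ℝ} {y : S}
    (hb : M.HasBody C T N) (hy : y ∉ T) {c : S} (hc : c ∈ C)
    (hD : M.coxeterGraph.Adj c y) : M.HasBody (insert y C) (insert y T) N := by
  obtain ⟨β, hβ, hβT, hβC, hβN⟩ := hb
  have hroot : ∀ s, (0 : ℝ) ≤ simpleRoot y s := fun s => by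
    rw [simpleRoot_apply]; split_ifs <;> norm_num
  refine ⟨β + simpleRoot y, fun s => add_nonneg (hβ s) (hroot s), fun s hs => ?_, fun s hs => ?_, ?_⟩
  · rw [Set.mem_insert_iff, not_or] at hs
    simp [hβT s hs.2, simpleRoot_apply, hs.1]
  · rcases eq_or_ne s y with rfl | hsy
    · simp [hβT s hy, simpleRoot_apply]
    · simp [hβC s (hs.resolve_left hsy), simpleRoot_apply, hsy]
  · have := h.rootForm_le (w := simpleRoot y) (T' := {y}) hβ hroot hβT
      (fun s hs => by rw [simpleRoot_apply, if_neg (by simpa using hs)]) (by simpa using hy) {c} y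
      (by simpa using hβC c hc) (by simp [simpleRoot_apply])
    rw [Finset.sum_singleton] at this
    -- The new root adds 1 to the norm, and the edge at most 2 · (-1/2).
    have h1 := h.canonicalForm_adj hD
    simp only [map_add, LinearMap.add_apply, M.rootForm_comm (simpleRoot y) β,
      rootForm_simpleRoot, canonicalForm_self]
    linarith

end Body

/-! ### Test vectors on paths. -/

section Path

variable {S : Type*} {M : CoxeterMatrix S}

/-- `f 0, …, f (n - 1)` is a path in the Coxeter graph. -/
structure IsPath (M : CoxeterMatrix S) (f : ℕ → S) (n : ℕ) : Prop where
  inj : ∀ i < n, ∀ j < n, f i = f j → i = j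
  adj : ∀ i, i + 1 < n → M.coxeterGraph.Adj (f i) (f (i + 1))

namespace IsPath

variable {f : ℕ → S} {n : ℕ}

theorem mono (hf : M.IsPath f n) {m : ℕ} (hm : m ≤ n) : M.IsPath f m :=
  ⟨fun i hi j hj => hf.inj i (by omega) j (by omega), fun i hi => hf.adj i (by omega)⟩

theorem reverse (hf : M.IsPath f n) : M.IsPath (fun i => f (n - 1 - i)) n := by
  refine ⟨fun i hi j hj hij => ?_, fun i hi => ?_⟩
  · have := hf.inj _ (by omega) _ (by omega) hij
    omega
  · have := hf.adj (n - 1 - (i + 1)) (by omega)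
    rw [show n - 1 - (i + 1) + 1 = n - 1 - i by omega] at this
    exact this.symm

theorem shift (hf : M.IsPath f n) (k : ℕ) : M.IsPath (fun i => f (k + i)) (n - k) := by
  refine ⟨fun i hi j hj hij => ?_, fun i hi => ?_⟩
  · have := hf.inj _ (by omega) _ (by omega) hij
    omega
  · exact hf.adj (k + i) (by omega)

theorem append (hf : M.IsPath f n) {u : S} (hu : ∀ i < n, f i ≠ u)
    (hadj : ∀ i, i + 1 = n → M.coxeterGraph.Adj (f i) u) :
    M.IsPath (fun i => if i < n then f i else u) (n + 1) := by
  refine ⟨fun i hi j hj hij => ?_, fun i hi => ?_⟩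
  · by_cases hi' : i < n <;> by_cases hj' : j < n
    · rw [if_pos hi', if_pos hj'] at hij
      exact hf.inj i hi' j hj' hij
    · rw [if_pos hi', if_neg hj'] at hij
      exact absurd hij (hu i hi')
    · rw [if_neg hi', if_pos hj'] at hij
      exact absurd hij.symm (hu j hj')
    · omega
  · rw [if_pos (by omega)]
    by_cases hi' : i + 1 < n
    · rw [if_pos hi']; exact hf.adj i hi'
    · rw [if_neg hi']; exact hadj i (by omega)

variable [Fintype S] [DecidableEq S]

theorem le_card (hf : M.IsPath f n) : n ≤ Fintype.card S := by
  have : Function.Injective (fun i : Fin n => f i) := fun i j hij =>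
    Fin.ext (hf.inj i i.2 j j.2 hij)
  simpa using Fintype.card_le_of_injective _ this

/-- The sum of the roots of a segment plays the role of a single root: the segment is contracted,
and neighbours of any of its vertices can be attached. -/
theorem hasBody_segment (h : M.IsSpherical) (hf : M.IsPath f n) {i j : ℕ} (hij : i ≤ j)
    (hj : j < n) : M.HasBody (f '' Set.Icc i j) (f '' Set.Icc i j) 1 := by
  induction j, hij using Nat.le_induction with
  | base => simpa using hasBody_singleton (M := M) (f i)
  | succ j hij ih =>
    have hI : f '' Set.Icc i (j + 1) = insert (f (j + 1)) (f '' Set.Icc i j) := by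
      rw [← Set.image_insert_eq]
      congr 1
      ext k; simp only [Set.mem_Icc, Set.mem_insert_iff]; omega
    rw [hI]
    refine (ih (by omega)).grow h ?_ (c := f j) ⟨j, by simp [hij], rfl⟩ (hf.adj j hj)
    rintro ⟨k, hk, hkj⟩
    have := hf.inj _ (by have := hk.2; omega) _ hj hkj
    have := hk.2
    omega

/-- A path of length `a` as an arm. -/
theorem hasBody_arm (h : M.IsSpherical) (a : ℕ) {f : ℕ → S} (hf : M.IsPath f (a + 1)) :
    M.HasBody {f 0} {s | ∃ i ≤ a, s = f i} ((a + 2) / (2 * (a + 1))) := by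
  induction a generalizing f with
  | zero =>
    have : {s | ∃ i ≤ 0, s = f i} = {f 0} := by ext s; simp
    rw [this]
    convert hasBody_singleton (M := M) (f 0) using 1
    norm_num
  | succ a ih =>
    have hs : M.IsPath (fun i => f (1 + i)) (a + 1) := by simpa using hf.shift 1
    -- The bound of an arm with `a + 1` vertices obeys N₀ = 1 and N_{a+1} = 1 - (1/4) / N_a.
    have := (hasBody_singleton (M := M) (f 0)).attach_one h (ih hs) (k := 1 / 2) ?_ subset_rfl
      (c := f 0) rfl (by norm_num) (h.canonicalForm_adj (hf.adj 0 (by omega)))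
    · convert this using 1
      · ext s
        simp only [Set.mem_ofPred_eq, Set.mem_union, Set.mem_singleton_iff]
        constructor
        · rintro ⟨i, hi, rfl⟩
          rcases Nat.eq_zero_or_pos i with rfl | hi0
          · exact Or.inl rfl
          · exact Or.inr ⟨i - 1, by omega, by rw [Nat.add_sub_cancel' hi0]⟩
        · rintro (rfl | ⟨i, hi, rfl⟩)
          · exact ⟨0, by omega, rfl⟩
          · exact ⟨1 + i, by omega, rfl⟩
      · push_cast
        field_simp
        ring
    · rw [Set.disjoint_singleton_left]
      rintro ⟨i, hi, hi0⟩
      have := hf.inj 0 (by omega) (1 + i) (by omega) hi0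
      omega

end IsPath

end Path

end CoxeterMatrix

/-! ### Forbidden subdiagrams. -/

namespace CoxeterMatrix

variable {S : Type*} [Fintype S] [DecidableEq S] {M : CoxeterMatrix S}

/-- The arms have `a + 1` and `b + 1` vertices; attached to the root at `c` they lower its norm
bound to 1 - k²/N_a - l²/N_b. -/
theorem IsSpherical.false_of_two_arms (h : M.IsSpherical) {c : S} {x y : ℕ → S} {a b : ℕ}
    {k l : ℝ} (hx : M.IsPath x (a + 1)) (hy : M.IsPath y (b + 1)) (hcx : ∀ i ≤ a, c ≠ x i)
    (hcy : ∀ i ≤ b, c ≠ y i) (hxy : ∀ i ≤ a, ∀ j ≤ b, x i ≠ y j) (hk : 0 ≤ k) (hl : 0 ≤ l)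
    (hkx : M.canonicalForm c (x 0) ≤ -k) (hly : M.canonicalForm c (y 0) ≤ -l)
    (hsum : 1 ≤ k ^ 2 / ((a + 2) / (2 * (a + 1))) + l ^ 2 / ((b + 2) / (2 * (b + 1)))) :
    False := by
  have h1 := (hasBody_singleton (M := M) c).attach_one h (hx.hasBody_arm h)
    (by rw [Set.disjoint_singleton_left]; rintro ⟨i, hi, hc⟩; exact hcx i hi hc)
    subset_rfl (c := c) rfl hk hkx
  have h2 := h1.attach_one h (hy.hasBody_arm h)
    (by
      rw [Set.disjoint_left]
      rintro s (hs | ⟨i, hi, rfl⟩) ⟨j, hj, hsj⟩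
      · exact hcy j hj (hs.symm.trans hsj)
      · exact hxy i hi j hj hsj)
    Set.subset_union_left (c := c) rfl hl hly
  have := h2.pos h (Set.singleton_nonempty c)
  linarith

/-- As 1/N_a = 2 - 2/(a + 2), the last hypothesis is the classical inequality 1/(a+2) + 1/(b+2) +
1/(d+2) ≤ 1. -/
theorem IsSpherical.false_of_three_arms (h : M.IsSpherical) {c : S} {x y z : ℕ → S} {a b d : ℕ}
    (hx : M.IsPath x (a + 1)) (hy : M.IsPath y (b + 1)) (hz : M.IsPath z (d + 1))
    (hcx : ∀ i ≤ a, c ≠ x i) (hcy : ∀ i ≤ b, c ≠ y i) (hcz : ∀ i ≤ d, c ≠ z i)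
    (hxy : ∀ i ≤ a, ∀ j ≤ b, x i ≠ y j) (hxz : ∀ i ≤ a, ∀ j ≤ d, x i ≠ z j)
    (hyz : ∀ i ≤ b, ∀ j ≤ d, y i ≠ z j) (hax : M.coxeterGraph.Adj c (x 0))
    (hay : M.coxeterGraph.Adj c (y 0)) (haz : M.coxeterGraph.Adj c (z 0))
    (hsum : (4 : ℝ) ≤ 1 / ((a + 2) / (2 * (a + 1))) + 1 / ((b + 2) / (2 * (b + 1))) +
      1 / ((d + 2) / (2 * (d + 1)))) :
    False := by
  have h1 := (hasBody_singleton (M := M) c).attach_one h (hx.hasBody_arm h)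
    (by rw [Set.disjoint_singleton_left]; rintro ⟨i, hi, hc⟩; exact hcx i hi hc)
    subset_rfl (c := c) rfl (by norm_num) (h.canonicalForm_adj hax)
  have h2 := h1.attach_one h (hy.hasBody_arm h)
    (by
      rw [Set.disjoint_left]
      rintro s (hs | ⟨i, hi, rfl⟩) ⟨j, hj, hsj⟩
      · exact hcy j hj (hs.symm.trans hsj)
      · exact hxy i hi j hj hsj)
    Set.subset_union_left (c := c) rfl (by norm_num) (h.canonicalForm_adj hay)
  have h3 := h2.attach_one h (hz.hasBody_arm h)
    (by
      rw [Set.disjoint_left]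
      rintro s ((hs | ⟨i, hi, rfl⟩) | ⟨i, hi, rfl⟩) ⟨j, hj, hsj⟩
      · exact hcz j hj (hs.symm.trans hsj)
      · exact hxz i hi j hj hsj
      · exact hyz i hi j hj hsj)
    (Set.subset_union_left.trans Set.subset_union_left) (c := c) rfl (by norm_num)
    (h.canonicalForm_adj haz)
  have := h3.pos h (Set.singleton_nonempty c)
  have e : ∀ N : ℝ, (1 / 2 : ℝ) ^ 2 / N = 1 / 4 * (1 / N) := fun N => by ring
  rw [e, e, e] at this
  linarith

theorem IsSpherical.canonicalForm_four (h : M.IsSpherical) {s t : S} (hst : 4 ≤ M s t) :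
    M.canonicalForm s t ≤ -(√2 / 2) := by
  simpa using h.canonicalForm_le (by norm_num) hst

theorem IsSpherical.canonicalForm_five (h : M.IsSpherical) {s t : S} (hst : 5 ≤ M s t) :
    M.canonicalForm s t ≤ -(4 / 5) := by
  refine (h.canonicalForm_le (by norm_num) hst).trans (neg_le_neg ?_)
  have h5 : (2.2 : ℝ) ≤ √5 := Real.le_sqrt_of_sq_le (by norm_num)
  have : cos (π / (5 : ℕ)) = (1 + √5) / 4 := by exact_mod_cast cos_pi_div_five
  rw [this]
  linarith

theorem IsSpherical.canonicalForm_six (h : M.IsSpherical) {s t : S} (hst : 6 ≤ M s t) :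
    M.canonicalForm s t ≤ -(√3 / 2) := by
  simpa using h.canonicalForm_le (by norm_num) hst

theorem IsSpherical.eq_two_of_not_adj (h : M.IsSpherical) {s t : S} (hst : s ≠ t)
    (hadj : ¬ M.coxeterGraph.Adj s t) : M s t = 2 := by
  rw [h.adj_iff] at hadj
  have := h.two_le hst
  have h3 : ¬ 3 ≤ M s t := fun h3 => hadj ⟨hst, h3⟩
  omega

namespace IsPath

omit [Fintype S] [DecidableEq S] in
theorem ne {f : ℕ → S} {n : ℕ} (hf : M.IsPath f n) {i j : ℕ} (hi : i < n) (hj : j < n)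
    (hij : i ≠ j) : f i ≠ f j := fun he => hij (hf.inj i hi j hj he)

omit [Fintype S] [DecidableEq S] in
theorem left {f : ℕ → S} {n : ℕ} (hf : M.IsPath f n) {i : ℕ} (hi : i ≤ n) :
    M.IsPath (fun k => f (i - 1 - k)) i := (hf.mono hi).reverse

omit [Fintype S] [DecidableEq S] in
theorem single (u : S) : M.IsPath (fun _ => u) 1 :=
  ⟨fun i hi j hj _ => by omega, fun i hi => by omega⟩

variable (h : M.IsSpherical) {f : ℕ → S} {n : ℕ} (hf : M.IsPath f n)

include h hf

theorem notMem_segment {i j k : ℕ} (hj : j < n) (hk : k < n) (hijk : k < i ∨ j < k) :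
    f k ∉ f '' Set.Icc i j := by
  rintro ⟨l, ⟨hl, hl'⟩, hlk⟩
  have := hf.inj l (by omega) k hk hlk
  omega

/-- No vertex is adjacent to two vertices of a path not containing it. -/
theorem false_of_adj_adj {i j : ℕ} {y : S} (hij : i < j) (hj : j < n)
    (hy : y ∉ f '' Set.Icc i j) (hi : M.coxeterGraph.Adj (f i) y)
    (hjy : M.coxeterGraph.Adj (f j) y) : False := by
  have hne : f i ≠ f j := hf.ne (by omega) hj hij.ne
  -- The two edges to `y` give `k = 1`, so the bound is 1 - 1 = 0; this excludes cycles.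
  have := (hf.hasBody_segment h hij.le hj).attach h (hasBody_singleton y) (by simpa using hy)
    subset_rfl {f i, f j} ?_ zero_le_one ?_
  · have := this.pos h ⟨f i, i, by simp [hij.le], rfl⟩
    norm_num at this
  · intro s hs
    rw [Finset.mem_insert, Finset.mem_singleton] at hs
    rcases hs with rfl | rfl
    · exact ⟨i, by simp [hij.le], rfl⟩
    · exact ⟨j, by simp [hij.le], rfl⟩
  · rw [Finset.sum_pair hne]
    have := h.canonicalForm_adj hi
    have := h.canonicalForm_adj hjy
    linarith

theorem eq_two {i j : ℕ} (hij : i + 2 ≤ j) (hj : j < n) : M (f i) (f j) = 2 := by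
  refine h.eq_two_of_not_adj (hf.ne (by omega) hj (by omega)) fun hadj => ?_
  have hadj' := hf.adj (j - 1) (by omega)
  rw [show j - 1 + 1 = j by omega] at hadj'
  exact hf.false_of_adj_adj h (i := i) (j := j - 1) (by omega) (by omega)
    (hf.notMem_segment h (by omega) hj (by omega)) hadj hadj'

/-- At most one edge of a path has a label greater than `3`. -/
theorem false_of_four_four {i j : ℕ} (hij : i < j) (hj : j + 1 < n)
    (hi4 : 4 ≤ M (f i) (f (i + 1))) (hj4 : 4 ≤ M (f j) (f (j + 1))) : False := by
  -- Contract the segment between the two edges and hang both outer ends on it: 1 - 1/2 - 1/2 = 0.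
  have hb := hf.hasBody_segment h (i := i + 1) (j := j) (by omega) (by omega)
  have h1 := hb.leaf h (y := f i) (hf.notMem_segment h (by omega) (by omega) (by omega)) subset_rfl
    (c := f (i + 1)) ⟨i + 1, by simp; omega, rfl⟩ (by positivity)
    (h.canonicalForm_four (by rwa [M.symmetric]))
  have h2 := h1.leaf h (y := f (j + 1)) ?_ (Set.subset_insert _ _)
    (c := f j) ⟨j, by simp; omega, rfl⟩ (by positivity) (h.canonicalForm_four hj4)
  · have := h2.pos h ⟨f j, j, by simp; omega, rfl⟩
    have h2 : √2 ^ 2 = 2 := Real.sq_sqrt (by norm_num)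
    nlinarith
  · rw [Set.mem_insert_iff, not_or]
    exact ⟨hf.ne hj (by omega) (by omega),
      hf.notMem_segment h (by omega) (by omega) (by omega)⟩

theorem false_of_two_arms {i a b : ℕ} {k l : ℝ} (hai : a + 1 ≤ i) (hbi : i + b + 1 < n)
    (hk : 0 ≤ k) (hl : 0 ≤ l) (hkx : M.canonicalForm (f i) (f (i - 1)) ≤ -k)
    (hly : M.canonicalForm (f i) (f (i + 1)) ≤ -l)
    (hsum : 1 ≤ k ^ 2 / ((a + 2) / (2 * (a + 1))) + l ^ 2 / ((b + 2) / (2 * (b + 1)))) :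
    False := by
  refine h.false_of_two_arms (c := f i) (a := a) (b := b) ((hf.left (i := i) (by omega)).mono hai)
    ((hf.shift (i + 1)).mono (by omega)) ?_ ?_ ?_ hk hl (by simpa using hkx) (by simpa using hly)
    hsum
  · exact fun j hj => hf.ne (by omega) (by omega) (by omega)
  · exact fun j hj => hf.ne (by omega) (by omega) (by omega)
  · exact fun j hj k hk => hf.ne (by omega) (by omega) (by omega)

theorem label_le_five (hn : 3 ≤ n) {i : ℕ} (hi : i + 1 < n) : M (f i) (f (i + 1)) ≤ 5 := by
  by_contra hlt
  push Not at hlt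
  have h6 : 6 ≤ M (f i) (f (i + 1)) := hlt
  have h3 : √3 ^ 2 = 3 := Real.sq_sqrt (by norm_num)
  by_cases hi0 : i = 0
  · subst hi0
    refine hf.false_of_two_arms h (i := 1) (a := 0) (b := 0) (by omega) (by omega)
      (k := √3 / 2) (l := 1 / 2) (by positivity) (by norm_num)
      (h.canonicalForm_six (by rwa [M.symmetric])) (h.canonicalForm_adj (hf.adj 1 (by omega))) ?_
    norm_num
    linarith
  · have := hf.adj (i - 1) (by omega)
    rw [show i - 1 + 1 = i by omega] at this
    refine hf.false_of_two_arms h (i := i) (a := 0) (b := 0) (by omega) (by omega)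
      (k := 1 / 2) (l := √3 / 2) (by norm_num) (by positivity)
      (h.canonicalForm_adj this.symm) (h.canonicalForm_six h6) ?_
    norm_num
    linarith

/-- An end label 5 followed by three further edges is excluded, and so is an inner label 5 with an
edge on each side; the rational bound 4/5 for cos (π/5) suffices in both cases. -/
theorem not_five_of_five_le (hn : 5 ≤ n) {i : ℕ} (hi : i + 1 < n) :
    M (f i) (f (i + 1)) < 5 := by
  by_contra hlt
  push Not at hlt
  have adjl : ∀ j, 0 < j → j < n → M.coxeterGraph.Adj (f j) (f (j - 1)) := fun j hj hjn => by
    have := hf.adj (j - 1) (by omega)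
    rw [show j - 1 + 1 = j by omega] at this
    exact this.symm
  by_cases hi0 : i = 0
  · subst hi0
    refine hf.false_of_two_arms h (i := 1) (a := 0) (b := 2) (by omega) (by omega)
      (k := 4 / 5) (l := 1 / 2) (by norm_num) (by norm_num)
      (h.canonicalForm_five (by rwa [M.symmetric])) (h.canonicalForm_adj (hf.adj 1 (by omega))) ?_
    norm_num
  by_cases hin : i + 2 = n
  · refine hf.false_of_two_arms h (i := i) (a := 2) (b := 0) (by omega) (by omega)
      (k := 1 / 2) (l := 4 / 5) (by norm_num) (by norm_num)
      (h.canonicalForm_adj (adjl i (by omega) (by omega))) (h.canonicalForm_five hlt) ?_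
    norm_num
  · refine hf.false_of_two_arms h (i := i) (a := 0) (b := 1) (by omega) (by omega)
      (k := 1 / 2) (l := 4 / 5) (by norm_num) (by norm_num)
      (h.canonicalForm_adj (adjl i (by omega) (by omega))) (h.canonicalForm_five hlt) ?_
    norm_num

/-- An inner label 4 produces the affine diagram F̃₄: two arms with two vertices each, 1/3 + 2/3 =
1. -/
theorem four_at_end (hn : 5 ≤ n) {i : ℕ} (hi : i + 1 < n) (h4 : 4 ≤ M (f i) (f (i + 1))) :
    i = 0 ∨ i + 2 = n := by
  by_contra hcon
  push Not at hcon
  have adjl : ∀ j, 0 < j → j < n → M.coxeterGraph.Adj (f j) (f (j - 1)) := fun j hj hjn => by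
    have := hf.adj (j - 1) (by omega)
    rw [show j - 1 + 1 = j by omega] at this
    exact this.symm
  have h2 : √2 ^ 2 = 2 := Real.sq_sqrt (by norm_num)
  by_cases hi2 : 2 ≤ i
  · refine hf.false_of_two_arms h (i := i) (a := 1) (b := 1) (by omega) (by omega)
      (k := 1 / 2) (l := √2 / 2) (by norm_num) (by positivity)
      (h.canonicalForm_adj (adjl i (by omega) (by omega))) (h.canonicalForm_four h4) ?_
    norm_num
    linarith
  · refine hf.false_of_two_arms h (i := i + 1) (a := 1) (b := 1) (by omega) (by omega)
      (k := √2 / 2) (l := 1 / 2) (by positivity) (by norm_num)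
      (h.canonicalForm_four (by rw [M.symmetric]; simpa using h4))
      (h.canonicalForm_adj (hf.adj _ (by omega))) ?_
    norm_num
    linarith

/-- This is affine type D̃: a contracted segment with four leaves, 1 - 4 · (1/4) = 0. -/
theorem false_of_fork {i j : ℕ} (hij : i ≤ j) (hi : 0 < i) (hj : j + 1 < n) {u v : S}
    (hu : ∀ k < n, f k ≠ u) (hv : ∀ k < n, f k ≠ v) (huv : u ≠ v)
    (hui : M.coxeterGraph.Adj (f i) u) (hvj : M.coxeterGraph.Adj (f j) v) : False := by
  have adjl : M.coxeterGraph.Adj (f i) (f (i - 1)) := by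
    have := hf.adj (i - 1) (by omega)
    rw [show i - 1 + 1 = i by omega] at this
    exact this.symm
  have hfi : f i ∈ f '' Set.Icc i j := ⟨i, by simp [hij], rfl⟩
  have hfj : f j ∈ f '' Set.Icc i j := ⟨j, by simp [hij], rfl⟩
  have hnot : ∀ {u}, (∀ k < n, f k ≠ u) → u ∉ f '' Set.Icc i j := by
    rintro u hu ⟨k, hk, hku⟩
    exact hu k (by have := hk.2; omega) hku
  have h2 : (0 : ℝ) ≤ 1 / 2 := by norm_num
  have hb := ((((hf.hasBody_segment h hij (by omega)).leaf h (y := f (i - 1))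
    (hf.notMem_segment h (by omega) (by omega) (by omega)) subset_rfl hfi h2
    (h.canonicalForm_adj adjl)).leaf h (y := f (j + 1)) ?_ (Set.subset_insert _ _) hfj h2
    (h.canonicalForm_adj (hf.adj j hj))).leaf h (y := u) ?_
    ((Set.subset_insert _ _).trans (Set.subset_insert _ _)) hfi h2
    (h.canonicalForm_adj hui)).leaf h (y := v) ?_
    (((Set.subset_insert _ _).trans (Set.subset_insert _ _)).trans (Set.subset_insert _ _)) hfj h2
    (h.canonicalForm_adj hvj)
  · have := hb.pos h ⟨_, hfi⟩
    norm_num at this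
  · rw [Set.mem_insert_iff, not_or]
    exact ⟨hf.ne hj (by omega) (by omega), hf.notMem_segment h (by omega) (by omega) (by omega)⟩
  · simp only [Set.mem_insert_iff, not_or]
    exact ⟨(hu _ hj).symm, (hu _ (by omega)).symm, hnot hu⟩
  · simp only [Set.mem_insert_iff, not_or]
    exact ⟨huv.symm, (hv _ hj).symm, (hv _ (by omega)).symm, hnot hv⟩

/-- If a branch is attached to an inner vertex of a path then the path has only labels `3`. -/
theorem label_eq_three_of_branch {i : ℕ} (hi : 0 < i) (hin : i + 1 < n) {u : S}
    (hu : ∀ k < n, f k ≠ u) (hui : M.coxeterGraph.Adj (f i) u) {j : ℕ} (hij : i ≤ j)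
    (hj : j + 1 < n) : M (f j) (f (j + 1)) = 3 := by
  have h3 := h.three_le (hf.adj j hj)
  by_contra hne
  have h4 : 4 ≤ M (f j) (f (j + 1)) := by omega
  have adjl : M.coxeterGraph.Adj (f i) (f (i - 1)) := by
    have := hf.adj (i - 1) (by omega)
    rw [show i - 1 + 1 = i by omega] at this
    exact this.symm
  have hfi : f i ∈ f '' Set.Icc i j := ⟨i, by simp [hij], rfl⟩
  have hfj : f j ∈ f '' Set.Icc i j := ⟨j, by simp [hij], rfl⟩
  have h2 : (0 : ℝ) ≤ 1 / 2 := by norm_num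
  -- Affine type B̃: leaves `f (i - 1)`, `u` and, across the label 4, `f (j + 1)`; 1 - 1/4 - 1/4 -
  -- 1/2 = 0.
  have hb := (((hf.hasBody_segment h hij (by omega)).leaf h (y := f (i - 1))
    (hf.notMem_segment h (by omega) (by omega) (by omega)) subset_rfl hfi h2
    (h.canonicalForm_adj adjl)).leaf h (y := f (j + 1)) ?_ (Set.subset_insert _ _) hfj
    (by positivity) (h.canonicalForm_four h4)).leaf h (y := u) ?_
    ((Set.subset_insert _ _).trans (Set.subset_insert _ _)) hfi h2
    (h.canonicalForm_adj hui)
  · have := hb.pos h ⟨_, hfi⟩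
    have h2 : √2 ^ 2 = 2 := Real.sq_sqrt (by norm_num)
    nlinarith
  · rw [Set.mem_insert_iff, not_or]
    exact ⟨hf.ne hj (by omega) (by omega), hf.notMem_segment h (by omega) (by omega) (by omega)⟩
  · simp only [Set.mem_insert_iff, not_or]
    refine ⟨(hu _ hj).symm, (hu _ (by omega)).symm, ?_⟩
    rintro ⟨k, hk, hku⟩
    exact hu k (by have := hk.2; omega) hku

theorem branch_label_eq_three {i : ℕ} (hi : 0 < i) (hin : i + 1 < n) {u : S}
    (hu : ∀ k < n, f k ≠ u) (hui : M.coxeterGraph.Adj (f i) u) : M (f i) u = 3 := by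
  have h3 := h.three_le hui
  by_contra hne
  have h4 : 4 ≤ M (f i) u := by omega
  have adjl : M.coxeterGraph.Adj (f i) (f (i - 1)) := by
    have := hf.adj (i - 1) (by omega)
    rw [show i - 1 + 1 = i by omega] at this
    exact this.symm
  have h2 : (0 : ℝ) ≤ 1 / 2 := by norm_num
  have hb := (((hasBody_singleton (M := M) (f i)).leaf h (y := f (i - 1))
    (by simpa using adjl.ne.symm) subset_rfl rfl h2
    (h.canonicalForm_adj adjl)).leaf h (y := f (i + 1)) ?_ (Set.subset_insert _ _) rfl h2
    (h.canonicalForm_adj (hf.adj i hin))).leaf h (y := u) ?_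
    ((Set.subset_insert _ _).trans (Set.subset_insert _ _)) rfl (by positivity)
    (h.canonicalForm_four h4)
  · have := hb.pos h (Set.singleton_nonempty _)
    have h2 : √2 ^ 2 = 2 := Real.sq_sqrt (by norm_num)
    nlinarith
  · simp only [Set.mem_insert_iff, not_or, Set.mem_singleton_iff]
    exact ⟨hf.ne hin (by omega) (by omega), hf.ne hin (by omega) (by omega)⟩
  · simp only [Set.mem_insert_iff, not_or, Set.mem_singleton_iff]
    exact ⟨(hu _ hin).symm, (hu _ (by omega)).symm, (hu _ (by omega)).symm⟩

theorem false_of_branch_arms {i a b : ℕ} (hai : a + 1 ≤ i) (hbi : i + b + 1 < n) {u : S}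
    (hu : ∀ k < n, f k ≠ u) (hui : M.coxeterGraph.Adj (f i) u)
    (hsum : (3 : ℝ) ≤ 1 / ((a + 2) / (2 * (a + 1))) + 1 / ((b + 2) / (2 * (b + 1)))) :
    False := by
  have adjl : M.coxeterGraph.Adj (f i) (f (i - 1)) := by
    have := hf.adj (i - 1) (by omega)
    rw [show i - 1 + 1 = i by omega] at this
    exact this.symm
  refine h.false_of_three_arms (c := f i) (a := a) (b := b) (d := 0)
    ((hf.left (i := i) (by omega)).mono hai)
    ((hf.shift (i + 1)).mono (by omega)) (single u) ?_ ?_ ?_ ?_ ?_ ?_ (by simpa using adjl)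
    (by simpa using hf.adj i (by omega)) hui ?_
  · exact fun j hj => hf.ne (by omega) (by omega) (by omega)
  · exact fun j hj => hf.ne (by omega) (by omega) (by omega)
  · exact fun j hj => hu _ (by omega)
  · exact fun j hj k hk => hf.ne (by omega) (by omega) (by omega)
  · exact fun j hj k hk => hu _ (by omega)
  · exact fun j hj k hk => hu _ (by omega)
  · norm_num at hsum ⊢
    linarith

/-- This is Ẽ₆: three arms with two vertices each. -/
theorem false_of_long_branch {i : ℕ} (hi : 2 ≤ i) (hin : i + 2 < n) {u v : S}
    (hu : ∀ k < n, f k ≠ u) (hv : ∀ k < n, f k ≠ v) (huv : M.coxeterGraph.Adj u v)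
    (hui : M.coxeterGraph.Adj (f i) u) : False := by
  have adjl : M.coxeterGraph.Adj (f i) (f (i - 1)) := by
    have := hf.adj (i - 1) (by omega)
    rw [show i - 1 + 1 = i by omega] at this
    exact this.symm
  have hz : M.IsPath (fun k => if k < 1 then u else v) 2 :=
    (single u).append (fun _ _ => huv.ne) (fun _ _ => huv)
  refine h.false_of_three_arms (c := f i) (a := 1) (b := 1) (d := 1)
    ((hf.left (i := i) (by omega)).mono hi)
    ((hf.shift (i + 1)).mono (by omega)) hz ?_ ?_ ?_ ?_ ?_ ?_ (by simpa using adjl)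
    (by simpa using hf.adj i (by omega)) (by simpa using hui) ?_
  · exact fun j hj => hf.ne (by omega) (by omega) (by omega)
  · exact fun j hj => hf.ne (by omega) (by omega) (by omega)
  · intro j hj; split_ifs
    · exact hu _ (by omega)
    · exact hv _ (by omega)
  · exact fun j hj k hk => hf.ne (by omega) (by omega) (by omega)
  · intro j hj k hk; split_ifs
    · exact hu _ (by omega)
    · exact hv _ (by omega)
  · intro j hj k hk; split_ifs
    · exact hu _ (by omega)
    · exact hv _ (by omega)
  · norm_num

end IsPath

end CoxeterMatrix

/-! ### A longest path and the vertices outside it. -/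

namespace CoxeterMatrix

variable {S : Type*} [Fintype S] [DecidableEq S] {M : CoxeterMatrix S}

theorem exists_longest_isPath (hconn : M.coxeterGraph.Connected) :
    ∃ f n, M.IsPath f n ∧ 1 ≤ n ∧ ∀ g m, M.IsPath g m → m ≤ n := by
  classical
  obtain ⟨s⟩ := hconn.nonempty
  have h1 : ∃ f, M.IsPath f 1 := ⟨_, IsPath.single s⟩
  have hcard : 1 ≤ Fintype.card S := (IsPath.single (M := M) s).le_card
  obtain ⟨f, hf⟩ := Nat.findGreatest_spec (P := fun n => ∃ f, M.IsPath f n) hcard h1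
  exact ⟨f, _, hf, Nat.le_findGreatest hcard h1, fun g m hg =>
    Nat.le_findGreatest hg.le_card ⟨g, hg⟩⟩

namespace IsPath

variable (h : M.IsSpherical) {f : ℕ → S} {n : ℕ} (hf : M.IsPath f n)
  (hmax : ∀ g m, M.IsPath g m → m ≤ n)

omit [Fintype S] [DecidableEq S] in
include hf hmax in
theorem interior_of_adj {i : ℕ} (hi : i < n) {u : S} (hu : ∀ k < n, f k ≠ u)
    (hui : M.coxeterGraph.Adj (f i) u) : 0 < i ∧ i + 1 < n := by
  constructor
  · by_contra hi0
    have := hmax _ _ (hf.reverse.append (u := u) (fun k hk => hu _ (by omega)) fun k hk => by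
      rwa [show n - 1 - k = i by omega])
    omega
  · by_contra hin
    have := hmax _ _ (hf.append hu fun k hk => by rwa [show k = i by omega])
    omega

omit [Fintype S] [DecidableEq S] in
include hf hmax in
-- The vertices `f 0, …, f i, u, v` form a path too.
theorem add_three_le {i : ℕ} (hi : i < n) {u v : S} (hu : ∀ k < n, f k ≠ u)
    (hv : ∀ k < n, f k ≠ v) (hui : M.coxeterGraph.Adj (f i) u) (huv : M.coxeterGraph.Adj u v) :
    i + 3 ≤ n := by
  have h1 := (hf.mono (m := i + 1) hi).append (u := u) (fun k hk => hu k (by omega)) fun k hk => by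
    rwa [show k = i by omega]
  refine hmax _ _ (h1.append (u := v) (fun k hk => ?_) fun k hk => ?_)
  · split_ifs
    · exact hv k (by omega)
    · exact huv.ne
  · rwa [if_neg (by omega)]

include h hf hmax

/-- A vertex outside of a longest path is unique. -/
theorem cover {i : ℕ} (hi : i < n) {u : S} (hu : ∀ k < n, f k ≠ u)
    (hui : M.coxeterGraph.Adj (f i) u) (hconn : M.coxeterGraph.Connected) (s : S) :
    s = u ∨ ∃ k < n, f k = s := by
  refine hconn.forall_of_adj (p := fun s => s = u ∨ ∃ k < n, f k = s) ?_ (Or.inl rfl) s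
  intro s v hsv hs
  by_contra hv
  push Not at hv
  obtain ⟨hvu, hv⟩ := hv
  -- A second outside vertex hanging on `u` yields Ẽ₆, as maximality leaves two path vertices on
  -- each side of `f i`; one hanging on the path yields D̃.
  rcases hs with rfl | ⟨j, hj, rfl⟩
  · have h1 := hf.add_three_le hmax hi hu hv hui hsv
    have h2 := hf.reverse.add_three_le hmax (i := n - 1 - i) (by omega)
      (fun k hk => hu _ (by omega)) (fun k hk => hv _ (by omega))
      (by rwa [show n - 1 - (n - 1 - i) = i by omega]) hsv
    exact hf.false_of_long_branch h (i := i) (by omega) (by omega) hu hv hsv hui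
  · have h1 := hf.interior_of_adj hmax hi hu hui
    have h2 := hf.interior_of_adj hmax hj hv hsv
    rcases le_total i j with hij | hij
    · exact hf.false_of_fork h hij h1.1 h2.2 hu hv hvu.symm hui hsv
    · exact hf.false_of_fork h hij h2.1 h1.2 hv hu hvu hsv hui

omit hmax in
theorem branch_label {i : ℕ} (hi : 0 < i) (hin : i + 1 < n) {u : S} (hu : ∀ k < n, f k ≠ u)
    (hui : M.coxeterGraph.Adj (f i) u) {j : ℕ} (hj : j < n) :
    M (f j) u = if j = i then 3 else 2 := by
  split_ifs with hji
  · subst hji; exact hf.branch_label_eq_three h hi hin hu hui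
  · refine h.eq_two_of_not_adj (hu j hj) fun hadj => ?_
    have hnot : ∀ a b, b < n → u ∉ f '' Set.Icc a b := by
      rintro a b hb ⟨k, hk, hku⟩
      exact hu k (by have := hk.2; omega) hku
    rcases lt_or_gt_of_ne hji with hlt | hlt
    · exact hf.false_of_adj_adj h hlt (by omega) (hnot _ _ (by omega)) hadj hui
    · exact hf.false_of_adj_adj h hlt hj (hnot _ _ hj) hui hadj

omit hmax in
theorem label_eq_three {i : ℕ} (hi : 0 < i) (hin : i + 1 < n) {u : S} (hu : ∀ k < n, f k ≠ u)
    (hui : M.coxeterGraph.Adj (f i) u) {j : ℕ} (hj : j + 1 < n) :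
    M (f j) (f (j + 1)) = 3 := by
  by_cases hij : i ≤ j
  · exact hf.label_eq_three_of_branch h hi hin hu hui hij hj
  · have := hf.reverse.label_eq_three_of_branch h (i := n - 1 - i) (j := n - 1 - (j + 1))
      (by omega) (by omega) (fun k hk => hu _ (by omega))
      (by rwa [show n - 1 - (n - 1 - i) = i by omega]) (by omega) (by omega)
    rw [show n - 1 - (n - 1 - (j + 1) + 1) = j by omega,
      show n - 1 - (n - 1 - (j + 1)) = j + 1 by omega] at this
    rwa [M.symmetric]

end IsPath

end CoxeterMatrix

/-! ### Characters of order two and foldings onto symmetric groups. -/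

theorem Equiv.Perm.eq_one_of_forall_commute_swap {α : Type*} [DecidableEq α]
    (hα : ∀ a b : α, ∃ c, c ≠ a ∧ c ≠ b) {σ : Equiv.Perm α}
    (hσ : ∀ a b, Commute σ (Equiv.swap a b)) : σ = 1 := by
  ext a
  by_contra! hne
  rw [Equiv.Perm.one_apply] at hne
  obtain ⟨c, hca, hcb⟩ := hα a (σ a)
  have := congrArg (fun τ : Equiv.Perm α => τ a) (hσ (σ a) c).eq
  simp only [Equiv.Perm.mul_apply, Equiv.swap_apply_left] at this
  rw [Equiv.swap_apply_of_ne_of_ne (Ne.symm hne) hca.symm] at this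
  exact hcb this.symm

namespace CoxeterSystem

open CoxeterMatrix

section Characters

variable {S : Type*} {M : CoxeterMatrix S} {W : Type*} [Group W] (cs : CoxeterSystem M W)

/-- The adjacent transposition attached to a height, trivial for heights `≥ N`. -/
def heightSwap (N k : ℕ) : Equiv.Perm (Fin (N + 1)) :=
  if hk : k < N then Equiv.swap ⟨k, by omega⟩ ⟨k + 1, by omega⟩ else 1

theorem heightSwap_mul_self (N k : ℕ) : heightSwap N k * heightSwap N k = 1 := by
  unfold heightSwap
  split_ifs <;> simp

theorem heightSwap_of_le {N k : ℕ} (hk : N ≤ k) : heightSwap N k = 1 := by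
  rw [heightSwap, dif_neg (by omega)]

theorem heightSwap_mul_pow_three {N k : ℕ} (hk : k + 1 < N) :
    (heightSwap N k * heightSwap N (k + 1)) ^ 3 = 1 := by
  rw [heightSwap, heightSwap, dif_pos (by omega), dif_pos hk, Equiv.swap_comm,
    ← (Equiv.Perm.isThreeCycle_swap_mul_swap_same (a := (⟨k + 1, by omega⟩ : Fin (N + 1)))
      (b := ⟨k, by omega⟩) (c := ⟨k + 1 + 1, by omega⟩) (by simp) (by simp)
      (by simp; omega)).orderOf, pow_orderOf_eq_one]

theorem heightSwap_commute {N k l : ℕ} (hkl : k + 1 < l) :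
    Commute (heightSwap N k) (heightSwap N l) := by
  by_cases hl : l < N
  · rw [heightSwap, heightSwap, dif_pos (by omega), dif_pos hl]
    apply Equiv.Perm.Disjoint.commute
    apply Equiv.Perm.disjoint_swap_swap
    simp
    omega
  · rw [heightSwap_of_le (by omega : N ≤ l)]
    exact Commute.one_right _

/-- A height function on the Coxeter graph which folds it onto a path of type `A_N`, forgetting the
vertices of height at least `N`. -/
structure IsFolding (M : CoxeterMatrix S) (N : ℕ) (g : S → ℕ) : Prop where
  surj : ∀ k < N, ∃ s, g s = k
  even_of_le : ∀ s t, g s < N → N ≤ g t → 2 ∣ M s t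
  even_of_lt : ∀ s t, g s + 1 < g t → g t < N → 2 ∣ M s t
  three_dvd : ∀ s t, g s + 1 = g t → g t < N → 3 ∣ M s t

theorem pow_eq_one_of_dvd {G : Type*} [Group G] {x : G} {a b : ℕ} (hx : x ^ a = 1) (hab : a ∣ b) :
    x ^ b = 1 := by
  obtain ⟨c, rfl⟩ := hab
  rw [pow_mul, hx, one_pow]

theorem IsFolding.isLiftable {N : ℕ} {g : S → ℕ} (hg : IsFolding M N g) :
    M.IsLiftable fun s => heightSwap N (g s) := by
  have hcomm : ∀ {x y : Equiv.Perm (Fin (N + 1))} {m : ℕ}, (x * y) ^ m = 1 → x * x = 1 →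
      y * y = 1 → (y * x) ^ m = 1 := by
    intro x y m hxy hx hy
    have h1 : y * x = (x * y)⁻¹ := by
      rw [mul_inv_rev, inv_eq_of_mul_eq_one_right hx, inv_eq_of_mul_eq_one_right hy]
    rw [h1, inv_pow, hxy, inv_one]
  have hmain : ∀ s t, g s < g t →
      (heightSwap N (g s) * heightSwap N (g t)) ^ M s t = 1 := by
    intro s t hst
    by_cases ht : g t < N
    · rcases eq_or_lt_of_le (Nat.succ_le_of_lt hst) with he | hlt
      · refine pow_eq_one_of_dvd ?_ (hg.three_dvd s t he ht)
        rw [← he]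
        exact heightSwap_mul_pow_three (by omega)
      · refine pow_eq_one_of_dvd ?_ (hg.even_of_lt s t hlt ht)
        rw [(heightSwap_commute hlt).mul_pow, sq, sq, heightSwap_mul_self, heightSwap_mul_self,
          one_mul]
    · rw [heightSwap_of_le (by omega : N ≤ g t), mul_one]
      by_cases hs : g s < N
      · refine pow_eq_one_of_dvd ?_ (hg.even_of_le s t hs (by omega))
        rw [sq, heightSwap_mul_self]
      · rw [heightSwap_of_le (by omega : N ≤ g s), one_pow]
  intro s t
  rcases lt_trichotomy (g s) (g t) with hst | hst | hst
  · exact hmain s t hst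
  · change (heightSwap N (g s) * heightSwap N (g t)) ^ M s t = 1
    rw [hst, heightSwap_mul_self, one_pow]
  · refine hcomm ?_ (heightSwap_mul_self _ _) (heightSwap_mul_self _ _)
    rw [M.symmetric]
    exact hmain t s hst

/-- A character that factors through a folding onto `A_N`, `N ≥ 2`, is trivial on the centre. -/
theorem IsFolding.eq_one {N : ℕ} (hN : 2 ≤ N) {g : S → ℕ} (hg : IsFolding M N g) {z : W}
    (hz : z ∈ Subgroup.center W) {φ : W →* ℤˣ}
    (hφ : ∀ s, φ (cs.simple s) = if g s < N then -1 else 1) : φ z = 1 := by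
  set ψ : W →* Equiv.Perm (Fin (N + 1)) := cs.lift ⟨_, hg.isLiftable⟩ with hψ
  have hψs : ∀ s, ψ (cs.simple s) = heightSwap N (g s) := fun s => cs.lift_apply_simple _ s
  -- It then suffices that `ψ z = 1`: `ψ` is onto, so `ψ z` is central in a symmetric group on at
  -- least three letters.
  have hfac : φ = Equiv.Perm.sign.comp ψ := by
    apply cs.ext_simple
    intro s
    rw [hφ, MonoidHom.comp_apply, hψs]
    split_ifs with hs
    · rw [heightSwap, dif_pos hs, Equiv.Perm.sign_swap (by simp)]
    · rw [heightSwap_of_le (by omega), map_one]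
  have hsurj : ∀ σ, σ ∈ MonoidHom.mrange ψ := by
    have : Submonoid.closure (Set.range fun i : Fin N => Equiv.swap i.castSucc i.succ) ≤
        MonoidHom.mrange ψ := by
      rw [Submonoid.closure_le]
      rintro _ ⟨i, rfl⟩
      obtain ⟨s, hs⟩ := hg.surj i i.2
      refine ⟨cs.simple s, ?_⟩
      rw [hψs, heightSwap, dif_pos (by omega)]
      simp only [hs]
      rfl
    rw [Equiv.Perm.mclosure_swap_castSucc_succ] at this
    exact fun σ => this trivial
  have hψz : ψ z = 1 := by
    apply Equiv.Perm.eq_one_of_forall_commute_swap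
    · intro a b
      have : ∃ c : Fin (N + 1), c ∉ ({a, b} : Finset (Fin (N + 1))) := by
        by_contra hcon
        push Not at hcon
        have h1 := Finset.card_le_card (fun c _ => hcon c : Finset.univ ⊆ {a, b})
        have h2 := Finset.card_le_two (a := a) (b := b)
        rw [Finset.card_univ, Fintype.card_fin] at h1
        omega
      obtain ⟨c, hc⟩ := this
      exact ⟨c, by simpa using hc⟩
    · intro a b
      obtain ⟨w, hw⟩ := hsurj (Equiv.swap a b)
      rw [← hw]
      exact (Subgroup.commute_of_mem_center hz (y := w)).map ψ
  rw [hfac, MonoidHom.comp_apply, hψz, map_one]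

/-- The sign character. -/
def signChar : W →* ℤˣ := cs.lift ⟨fun _ => -1, fun _ _ => by simp⟩

@[simp] theorem signChar_simple (s : S) : cs.signChar (cs.simple s) = -1 :=
  cs.lift_apply_simple _ s

theorem eq_signChar {φ : W →* ℤˣ} (hφ : ∀ s, φ (cs.simple s) = -1) : φ = cs.signChar :=
  cs.ext_simple fun s => by rw [hφ, signChar_simple]

theorem apply_simple_eq_of_odd (φ : W →* ℤˣ) {s t : S} (hst : Odd (M s t)) :
    φ (cs.simple s) = φ (cs.simple t) := by
  have := congrArg φ (cs.simple_mul_simple_pow s t)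
  rw [map_pow, map_mul, map_one] at this
  obtain ⟨k, hk⟩ := hst
  change M s t = 2 * k + 1 at hk
  rw [show M.M s t = 2 * k + 1 from hk, pow_succ, pow_mul, Int.units_sq, one_pow, one_mul] at this
  rw [← mul_one (φ (cs.simple s)), ← Int.units_mul_self (φ (cs.simple t)), ← mul_assoc, this,
    one_mul]

end Characters

variable {S : Type*} [Fintype S] [DecidableEq S] {M : CoxeterMatrix S}
  {W : Type*} [Group W] (cs : CoxeterSystem M W) (h : M.IsSpherical)

theorem _root_.CoxeterMatrix.det_simpleReflection (s : S) :
    LinearMap.det (M.simpleReflection s) = -1 := by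
  -- As a transvection x + f(x) v with f(v) = -2 it has determinant 1 + f(v) = -1.
  have : M.simpleReflection s =
      LinearMap.transvection ((-2 : ℝ) • M.rootForm (simpleRoot s)) (simpleRoot s) := by
    ext1 x; ext1
    simp [simpleReflection_apply, LinearMap.transvection.apply, sub_eq_add_neg]
  rw [this, LinearMap.transvection.det]
  simp
  norm_num

theorem signChar_eq_det (w : W) :
    ((cs.signChar w : ℤ) : ℝ) = LinearMap.det (cs.geomRep h w) := by
  have : ((Int.castRingHom ℝ : ℤ →* ℝ).comp ((Units.coeHom ℤ).comp cs.signChar)) =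
      (LinearMap.det).comp (cs.geomRep h) := by
    apply cs.ext_simple
    intro s
    simp [det_simpleReflection]
  exact DFunLike.congr_fun this w

theorem signChar_of_geomRep {z : W} (hz : cs.geomRep h z = -1) :
    cs.signChar z = (-1) ^ Fintype.card S := by
  have h1 := cs.signChar_eq_det h z
  rw [hz, ← neg_one_smul ℝ (1 : Module.End ℝ (S → ℝ)), LinearMap.det_smul, map_one, mul_one,
    Module.finrank_fintype_fun_eq_card] at h1
  apply Units.ext
  push_cast
  exact_mod_cast h1

end CoxeterSystem

/-! ### Recognising labelled graphs from paths. -/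

namespace CoxeterMatrix

/-- Injectivity of `g` is automatic: an entry equals 1 on the diagonal only. -/
theorem sameType_of_forall_eq {S : Type*} {M : CoxeterMatrix S} {k : ℕ} {N : CoxeterMatrix (Fin k)}
    (g : Fin k → S) (hg : Function.Surjective g) (hMN : ∀ a b, M (g a) (g b) = N a b) :
    M.SameType N := by
  have hinj : Function.Injective g := by
    intro a b hab
    by_contra hne
    have := hMN a b
    rw [hab, M.diagonal] at this
    exact N.off_diagonal a b hne this.symm
  refine ⟨(Equiv.ofBijective g ⟨hinj, hg⟩).symm, ?_⟩
  ext i j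
  exact hMN i j

variable {S : Type*} [Fintype S] [DecidableEq S] {M : CoxeterMatrix S}

namespace IsPath

variable (h : M.IsSpherical) {f : ℕ → S} {n : ℕ} (hf : M.IsPath f n)

omit [DecidableEq S] in
include hf in
theorem card_eq (hsurj : ∀ s, ∃ k < n, f k = s) : Fintype.card S = n := by
  have : Function.Bijective (fun i : Fin n => f i) :=
    ⟨fun i j hij => Fin.ext (hf.inj i i.2 j j.2 hij), fun s => by
      obtain ⟨k, hk, hks⟩ := hsurj s
      exact ⟨⟨k, hk⟩, hks⟩⟩
  simpa using (Fintype.card_of_bijective this).symm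

omit [DecidableEq S] in
include hf in
theorem card_eq_succ {u : S} (hu : ∀ k < n, f k ≠ u) (hcov : ∀ s, s = u ∨ ∃ k < n, f k = s) :
    Fintype.card S = n + 1 := by
  have hadd : Function.Bijective (fun i : Option (Fin n) => i.elim u fun i => f i) := by
    constructor
    · rintro (_ | i) (_ | j) hij
      · rfl
      · exact absurd hij.symm (hu j j.2)
      · exact absurd hij (hu i i.2)
      · exact congrArg some (Fin.ext (hf.inj i i.2 j j.2 hij))
    · intro s
      rcases hcov s with rfl | ⟨k, hk, rfl⟩
      · exact ⟨none, rfl⟩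
      · exact ⟨some ⟨k, hk⟩, rfl⟩
  simpa using (Fintype.card_of_bijective hadd).symm

include h hf

theorem eq_two_of_ne {i j : ℕ} (hi : i < n) (hj : j < n) (hij : i ≠ j) (h1 : i + 1 ≠ j)
    (h2 : j + 1 ≠ i) : M (f i) (f j) = 2 := by
  rcases lt_or_gt_of_ne hij with hlt | hlt
  · exact hf.eq_two h (by omega) hj
  · rw [M.symmetric]; exact hf.eq_two h (by omega) hi

theorem forall_label (P : ℕ → Prop) (hP : ∀ k, k + 1 < n → P (M (f k) (f (k + 1)))) {i j : ℕ}
    (hi : i < n) (hj : j < n) (hij : M.coxeterGraph.Adj (f i) (f j)) : P (M (f i) (f j)) := by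
  have h3 := h.three_le hij
  by_cases h1 : i + 1 = j
  · subst h1; exact hP i hj
  · by_cases h2 : j + 1 = i
    · subst h2; rw [M.symmetric]; exact hP j hi
    · have hne : i ≠ j := fun he => hij.ne (congrArg f he)
      have := hf.eq_two_of_ne h hi hj hne h1 h2
      omega

theorem sameType_B (hsurj : ∀ s, ∃ k < n, f k = s)
    (hlab : ∀ k, k + 2 < n → M (f k) (f (k + 1)) = 3)
    (h4 : ∀ k, k + 2 = n → M (f k) (f (k + 1)) = 4) : M.SameType (CoxeterMatrix.B n) := by
  refine sameType_of_forall_eq (fun i => f i) (fun s => ?_) fun a b => ?_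
  · obtain ⟨k, hk, hks⟩ := hsurj s
    exact ⟨⟨k, hk⟩, hks⟩
  · have hlab' : ∀ k, k + 1 < n → M (f k) (f (k + 1)) = if k + 2 = n then 4 else 3 := by
      intro k hk
      split_ifs with hkn
      · exact h4 k hkn
      · exact hlab k (by omega)
    obtain ⟨a, ha⟩ := a
    obtain ⟨b, hb⟩ := b
    change _ = (if (⟨a, ha⟩ : Fin n) = ⟨b, hb⟩ then 1 else if a = n - 1 ∧ b = n - 2 ∨ b = n - 1 ∧ a = n - 2 then 4
      else if b + 1 = a ∨ a + 1 = b then 3 else 2)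
    simp only [Fin.mk.injEq]
    rcases eq_or_ne a b with rfl | hab
    · simp
    by_cases h1 : a + 1 = b
    · subst h1
      have := hlab' a hb
      rw [this]
      split_ifs <;> omega
    by_cases h2 : b + 1 = a
    · subst h2
      have := hlab' b ha
      rw [M.symmetric, this]
      split_ifs <;> omega
    · have := hf.eq_two_of_ne h ha hb hab h1 h2
      change M (f a) (f b) = _
      rw [this]
      split_ifs <;> omega

theorem isFolding (hsurj : ∀ s, ∃ k < n, f k = s) {N : ℕ} (hN : N ≤ n)
    (hlab : ∀ k, k + 1 < N → M (f k) (f (k + 1)) = 3)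
    (hev : ∀ k, k + 1 = N → N < n → 2 ∣ M (f k) (f (k + 1))) :
    ∃ g : S → ℕ, (∀ k < n, g (f k) = k) ∧ CoxeterSystem.IsFolding M N g := by
  choose g hgn hfg using hsurj
  have hg : ∀ k < n, g (f k) = k := fun k hk => hf.inj _ (hgn _) _ hk (hfg _)
  refine ⟨g, hg, fun k hk => ⟨f k, hg k (by omega)⟩, fun s t hs ht => ?_, fun s t hst ht => ?_,
    fun s t hst ht => ?_⟩
  · by_cases h1 : g s + 1 = g t
    · have := hev (g s) (by omega) (by have := hgn t; omega)
      rwa [h1, hfg, hfg] at this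
    · have := hf.eq_two_of_ne h (hgn s) (hgn t) (by omega) h1 (by omega)
      rw [hfg, hfg] at this
      rw [this]
  · have := hf.eq_two h (i := g s) (j := g t) hst (hgn t)
    rw [hfg, hfg] at this
    rw [this]
  · have := hlab (g s) (by omega)
    rw [hst, hfg, hfg] at this
    rw [this]

end IsPath

end CoxeterMatrix

/-! ### Excluding characters by parity of the rank and by quotients. -/

namespace CoxeterSystem

open CoxeterMatrix

/-- The character of the dihedral group of order `8` which is `-1` on `sr 0` and `1` on `sr 1`. -/
def dihedralChar : DihedralGroup 4 →* ℤˣ :=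
  MonoidHom.mk' (fun
    | .r i => if i.val % 2 = 0 then 1 else -1
    | .sr i => if i.val % 2 = 0 then -1 else 1) (by decide)

variable {S : Type*} [Fintype S] [DecidableEq S] {M : CoxeterMatrix S}
  {W : Type*} [Group W] (cs : CoxeterSystem M W) (h : M.IsSpherical)
  (hconn : M.coxeterGraph.Connected) {z : W} (hz : z ∈ Subgroup.center W)

include cs h hconn hz

theorem signChar_of_mem_center (hz1 : z ≠ 1) : cs.signChar z = (-1) ^ Fintype.card S :=
  cs.signChar_of_geomRep h (cs.geomRep_of_mem_center h hconn hz hz1)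

theorem signChar_of_even (hcard : Even (Fintype.card S)) : cs.signChar z = 1 := by
  by_cases hz1 : z = 1
  · rw [hz1, map_one]
  · rw [cs.signChar_of_mem_center h hconn hz hz1, hcard.neg_one_pow]

omit [Fintype S] [DecidableEq S] h hz in
-- Across an odd label `φ` takes equal values, so it is constant on the simple reflections; the
-- constant 1 would make it trivial at `z`.
theorem eq_signChar_of_odd {φ : W →* ℤˣ} (hφ : φ z = -1)
    (hodd : ∀ s t, M.coxeterGraph.Adj s t → Odd (M s t)) : φ = cs.signChar := by
  apply cs.eq_signChar
  obtain ⟨s₀⟩ := hconn.nonempty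
  have hall : ∀ s, φ (cs.simple s) = φ (cs.simple s₀) := fun s =>
    hconn.forall_of_adj (p := fun s => φ (cs.simple s) = φ (cs.simple s₀))
      (fun s t hst hs => (cs.apply_simple_eq_of_odd φ (hodd s t hst)).symm.trans hs) rfl s
  rcases Int.units_eq_one_or (φ (cs.simple s₀)) with h1 | h1
  · exfalso
    have : φ = 1 := cs.ext_simple fun s => by rw [hall, h1, MonoidHom.one_apply]
    rw [this, MonoidHom.one_apply] at hφ
    exact absurd hφ (by decide)
  · exact fun s => (hall s).trans h1

theorem odd_card_of_odd {φ : W →* ℤˣ} (hφ : φ z = -1)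
    (hodd : ∀ s t, M.coxeterGraph.Adj s t → Odd (M s t)) : Odd (Fintype.card S) := by
  rw [← Nat.not_even_iff_odd]
  intro heven
  rw [cs.eq_signChar_of_odd hconn hφ hodd, cs.signChar_of_even h hconn hz heven] at hφ
  exact absurd hφ (by decide)

/-- On a group of even rank whose Coxeter graph is a path with one label `4`, not at the start, all
characters are trivial on the centre. -/
theorem false_of_even_four {f : ℕ → S} {n : ℕ} (hf : M.IsPath f n) (hsurj : ∀ s, ∃ k < n, f k = s)
    (hn : Even n) {j : ℕ} (hj : 1 ≤ j) (hjn : j + 1 < n) (h4 : M (f j) (f (j + 1)) = 4)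
    (h3 : ∀ k, k + 1 < n → k ≠ j → M (f k) (f (k + 1)) = 3) {φ : W →* ℤˣ} (hφ : φ z = -1) :
    False := by
  -- In even rank the sign character is 1 on `z`, so multiplying by it normalises `φ` to be 1 beyond
  -- the label 4. Then `φ` is trivial or factors through the folding that keeps the first `j + 1 ≥
  -- 2` vertices.
  have key : ∀ φ : W →* ℤˣ, φ z = -1 → φ (cs.simple (f (j + 1))) = 1 → False := by
    intro φ hφ hφj
    have hlow : ∀ k, k ≤ j → φ (cs.simple (f k)) = φ (cs.simple (f 0)) := by
      intro k hk
      induction k with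
      | zero => rfl
      | succ k ih =>
        rw [← ih (by omega)]
        exact (cs.apply_simple_eq_of_odd φ
          (by rw [h3 k (by omega) (by omega)]; decide)).symm
    have hhigh : ∀ k, j + 1 ≤ k → k < n → φ (cs.simple (f k)) = 1 := by
      intro k hk
      induction k, hk using Nat.le_induction with
      | base => exact fun _ => hφj
      | succ k hk ih =>
        intro hkn
        rw [← ih (by omega)]
        exact (cs.apply_simple_eq_of_odd φ
          (by rw [h3 k (by omega) (by omega)]; decide)).symm
    rcases Int.units_eq_one_or (φ (cs.simple (f 0))) with h1 | h1
    · have : φ = 1 := cs.ext_simple fun s => by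
        obtain ⟨k, hk, rfl⟩ := hsurj s
        rw [MonoidHom.one_apply]
        by_cases hkj : k ≤ j
        · rw [hlow k hkj, h1]
        · exact hhigh k (by omega) hk
      rw [this, MonoidHom.one_apply] at hφ
      exact absurd hφ (by decide)
    · obtain ⟨g, hg, hfold⟩ := hf.isFolding h hsurj (N := j + 1) (by omega)
        (fun k hk => h3 k (by omega) (by omega))
        (fun k hk _ => by
          obtain rfl : k = j := by omega
          rw [h4]; decide)
      have := hfold.eq_one cs (by omega) hz (φ := φ) fun s => by
        obtain ⟨k, hk, rfl⟩ := hsurj s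
        rw [hg k hk]
        split_ifs with hkj
        · rw [hlow k (by omega), h1]
        · exact hhigh k (by omega) hk
      rw [this] at hφ
      exact absurd hφ (by decide)
  rcases Int.units_eq_one_or (φ (cs.simple (f (j + 1)))) with h1 | h1
  · exact key φ hφ h1
  · refine key (φ * cs.signChar) ?_ ?_
    · rw [MonoidHom.mul_apply, hφ, cs.signChar_of_even h hconn hz (by rwa [hf.card_eq hsurj])]
      rfl
    · rw [MonoidHom.mul_apply, h1, signChar_simple]
      rfl

/-- After normalisation by the sign character, `φ` factors through the dihedral group of order 8,
whose centre lies in the kernel of `dihedralChar`. -/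
theorem false_of_four_dvd {f : ℕ → S} (hf : M.IsPath f 2) (hsurj : ∀ s, ∃ k < 2, f k = s)
    (h4 : 4 ∣ M (f 0) (f 1)) {φ : W →* ℤˣ} (hφ : φ z = -1) : False := by
  have hne : f 0 ≠ f 1 := hf.ne (by norm_num) (by norm_num) (by norm_num)
  have key : ∀ φ : W →* ℤˣ, φ z = -1 → φ (cs.simple (f 1)) = 1 → False := by
    intro φ hφ h1
    have h0 : φ (cs.simple (f 0)) = -1 := by
      refine (Int.units_eq_one_or _).resolve_left fun h0 => ?_
      have : φ = 1 := cs.ext_simple fun s => by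
        obtain ⟨k, hk, rfl⟩ := hsurj s
        interval_cases k
        · rw [h0]; rfl
        · rw [h1]; rfl
      rw [this, MonoidHom.one_apply] at hφ
      exact absurd hφ (by decide)
    have hlift : M.IsLiftable fun s =>
        if s = f 0 then (DihedralGroup.sr 0 : DihedralGroup 4) else DihedralGroup.sr 1 := by
      intro s t
      have h01 : (DihedralGroup.sr 0 * DihedralGroup.sr 1 : DihedralGroup 4) ^ 4 = 1 := by decide
      have h10 : (DihedralGroup.sr 1 * DihedralGroup.sr 0 : DihedralGroup 4) ^ 4 = 1 := by decide
      obtain ⟨a, ha, rfl⟩ := hsurj s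
      obtain ⟨b, hb, rfl⟩ := hsurj t
      interval_cases a <;> interval_cases b
      · simp
      · simpa [hne.symm] using pow_eq_one_of_dvd h01 h4
      · rw [M.symmetric]
        simpa [hne.symm] using pow_eq_one_of_dvd h10 h4
      · have h11 : (DihedralGroup.sr 1 * DihedralGroup.sr 1 : DihedralGroup 4) = 1 := by decide
        simp only [hne.symm, if_false, h11, one_pow]
    set ψ : W →* DihedralGroup 4 := cs.lift ⟨_, hlift⟩ with hψ
    have hψ0 : ψ (cs.simple (f 0)) = DihedralGroup.sr 0 := by
      rw [hψ, cs.lift_apply_simple hlift, if_pos rfl]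
    have hψ1 : ψ (cs.simple (f 1)) = DihedralGroup.sr 1 := by
      rw [hψ, cs.lift_apply_simple hlift, if_neg hne.symm]
    have hfac : φ = dihedralChar.comp ψ := by
      apply cs.ext_simple
      intro s
      obtain ⟨k, hk, rfl⟩ := hsurj s
      interval_cases k
      · rw [MonoidHom.comp_apply, hψ0, h0]; rfl
      · rw [MonoidHom.comp_apply, hψ1, h1]; rfl
    have hcomm : ∀ x : DihedralGroup 4,
        x * DihedralGroup.sr 0 = DihedralGroup.sr 0 * x →
        x * DihedralGroup.sr 1 = DihedralGroup.sr 1 * x → dihedralChar x = 1 := by decide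
    have := hcomm (ψ z) (by
      rw [← hψ0]; exact ((Subgroup.commute_of_mem_center hz).map ψ).eq) (by
      rw [← hψ1]; exact ((Subgroup.commute_of_mem_center hz).map ψ).eq)
    rw [hfac, MonoidHom.comp_apply, this] at hφ
    exact absurd hφ (by decide)
  rcases Int.units_eq_one_or (φ (cs.simple (f 1))) with h1 | h1
  · exact key φ hφ h1
  · refine key (φ * cs.signChar) ?_ ?_
    · rw [MonoidHom.mul_apply, hφ,
        cs.signChar_of_even h hconn hz (by rw [hf.card_eq hsurj]; decide)]
      rfl
    · rw [MonoidHom.mul_apply, h1, signChar_simple]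
      rfl

end CoxeterSystem

namespace CoxeterMatrix

/-- The types of irreducible Coxeter groups of spherical type that are decomposable. -/
def IsDecomposableType {S : Type*} (M : CoxeterMatrix S) : Prop :=
  (∃ m : ℕ, 6 ≤ m + 2 ∧ (m + 2) % 4 = 2 ∧ M.SameType (CoxeterMatrix.I m)) ∨
    (∃ n : ℕ, 3 ≤ n ∧ Odd n ∧ M.SameType (CoxeterMatrix.B n)) ∨
    M.SameType CoxeterMatrix.H₃ ∨ M.SameType CoxeterMatrix.E₇

end CoxeterMatrix

namespace CoxeterSystem

open CoxeterMatrix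

variable {S : Type*} [Fintype S] [DecidableEq S] {M : CoxeterMatrix S}
  {W : Type*} [Group W] (cs : CoxeterSystem M W) (h : M.IsSpherical)
  (hconn : M.coxeterGraph.Connected) {z : W} (hz : z ∈ Subgroup.center W)

include cs h hconn hz

/-- At most one label exceeds 3. With none, the group folds onto a symmetric group; in rank 2 the
label decides modulo 4. In higher rank, a label 4 forces `n` odd and then sits at an end, and a
label 5 keeps all labels odd, so `n` is odd and below 5. -/
theorem isDecomposableType_of_path {f : ℕ → S} {n : ℕ} (hf : M.IsPath f n) (hn : 2 ≤ n)
    (hsurj : ∀ s, ∃ k < n, f k = s) {φ : W →* ℤˣ} (hφ : φ z = -1) : M.IsDecomposableType := by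
  have hodd : (∀ k, k + 1 < n → Odd (M (f k) (f (k + 1)))) →
      ∀ s t, M.coxeterGraph.Adj s t → Odd (M s t) := by
    intro hlab s t hst
    obtain ⟨a, ha, rfl⟩ := hsurj s
    obtain ⟨b, hb, rfl⟩ := hsurj t
    exact hf.forall_label h Odd hlab ha hb hst
  have h3 : ∀ k, k + 1 < n → 3 ≤ M (f k) (f (k + 1)) := fun k hk => h.three_le (hf.adj k hk)
  by_cases hall : ∀ k, k + 1 < n → M (f k) (f (k + 1)) = 3
  · exfalso
    have hφs := cs.eq_signChar_of_odd hconn hφ (hodd fun k hk => by rw [hall k hk]; decide)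
    obtain ⟨g, hg, hfold⟩ := hf.isFolding h hsurj le_rfl hall (fun k hk hlt => by omega)
    have := hfold.eq_one cs hn hz (φ := φ) fun s => by
      obtain ⟨k, hk, rfl⟩ := hsurj s
      rw [hg k hk, if_pos hk, hφs, signChar_simple]
    rw [this] at hφ
    exact absurd hφ (by decide)
  push Not at hall
  obtain ⟨j, hj, hj3⟩ := hall
  have hj4 : 4 ≤ M (f j) (f (j + 1)) := by have := h3 j hj; omega
  have hother : ∀ k, k + 1 < n → k ≠ j → M (f k) (f (k + 1)) = 3 := by
    intro k hk hkj
    by_contra hne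
    have hk4 : 4 ≤ M (f k) (f (k + 1)) := by have := h3 k hk; omega
    rcases lt_or_gt_of_ne hkj with hlt | hlt
    · exact hf.false_of_four_four h hlt hj hk4 hj4
    · exact hf.false_of_four_four h hlt hk hj4 hk4
  rcases eq_or_lt_of_le hn with rfl | hn3
  · obtain rfl : j = 0 := by omega
    change 4 ≤ M (f 0) (f 1) at hj4
    have hmod : M (f 0) (f 1) % 4 = 2 := by
      by_contra hmod
      by_cases h4 : 4 ∣ M (f 0) (f 1)
      · exact cs.false_of_four_dvd h hconn hz hf hsurj h4 hφ
      · have := cs.odd_card_of_odd h hconn hz hφ (hodd fun k hk => by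
          obtain rfl : k = 0 := by omega
          change Odd (M (f 0) (f 1))
          rw [Nat.odd_iff]
          omega)
        rw [hf.card_eq hsurj] at this
        exact absurd this (by decide)
    refine Or.inl ⟨M (f 0) (f 1) - 2, by omega, by omega,
      sameType_of_forall_eq (fun i => f i) (fun s => ?_) fun a b => ?_⟩
    · obtain ⟨k, hk, hks⟩ := hsurj s
      exact ⟨⟨k, hk⟩, hks⟩
    · have hI : ∀ m (a b : Fin 2), CoxeterMatrix.I m a b = if a = b then 1 else m + 2 :=
        fun _ _ _ => rfl
      rw [hI]
      fin_cases a <;> fin_cases b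
      · simp
      · change M (f 0) (f 1) = M (f 0) (f 1) - 2 + 2
        omega
      · change M (f 1) (f 0) = M (f 0) (f 1) - 2 + 2
        rw [M.symmetric]
        omega
      · simp
  have hj5 := hf.label_le_five h hn3 hj
  rcases eq_or_lt_of_le hj4 with hj4 | hj5'
  · -- the label is `4`
    have hnodd : Odd n := by
      rw [← Nat.not_even_iff_odd]
      intro heven
      -- The exclusion lemma needs at least two vertices before the label 4, so a label 4 at the
      -- start is moved to the other end by reversing the path.
      by_cases hj0 : j = 0
      · subst hj0
        refine cs.false_of_even_four h hconn hz hf.reverse (j := n - 2)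
          (fun s => ?_) heven (by omega) (by omega) ?_ (fun k hk hkj => ?_) hφ
        · obtain ⟨k, hk, hks⟩ := hsurj s
          exact ⟨n - 1 - k, by omega, by rw [show n - 1 - (n - 1 - k) = k by omega, hks]⟩
        · rw [M.symmetric, show n - 1 - (n - 2 + 1) = 0 by omega,
            show n - 1 - (n - 2) = 0 + 1 by omega]
          exact hj4.symm
        · rw [M.symmetric, show n - 1 - k = n - 1 - (k + 1) + 1 by omega]
          exact hother _ (by omega) (by omega)
      · exact cs.false_of_even_four h hconn hz hf hsurj heven (by omega) hj hj4.symm hother hφ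
    refine Or.inr (Or.inl ⟨n, hn3, hnodd, ?_⟩)
    have hend : j = 0 ∨ j + 2 = n := by
      by_cases hn5 : 5 ≤ n
      · exact hf.four_at_end h hn5 hj hj4.le
      · have : n = 3 := by
          obtain ⟨k, hk⟩ := hnodd
          omega
        omega
    rcases hend with rfl | hend
    · refine hf.reverse.sameType_B h (fun s => ?_) (fun k hk => ?_) (fun k hk => ?_)
      · obtain ⟨k, hk, hks⟩ := hsurj s
        exact ⟨n - 1 - k, by omega, by rw [show n - 1 - (n - 1 - k) = k by omega, hks]⟩
      · rw [M.symmetric, show n - 1 - k = n - 1 - (k + 1) + 1 by omega]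
        exact hother _ (by omega) (by omega)
      · rw [M.symmetric, show n - 1 - (k + 1) = 0 by omega, show n - 1 - k = 0 + 1 by omega]
        exact hj4.symm
    · refine hf.sameType_B h hsurj (fun k hk => hother k (by omega) (by omega)) (fun k hk => ?_)
      obtain rfl : k = j := by omega
      exact hj4.symm
  · -- the label is `5`
    have hj5 : M (f j) (f (j + 1)) = 5 := by omega
    have hn5 : n < 5 := by
      by_contra hn5
      exact absurd (hf.not_five_of_five_le h (by omega) hj) (by omega)
    have hnodd := cs.odd_card_of_odd h hconn hz hφ (hodd fun k hk => by
      by_cases hkj : k = j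
      · subst hkj; rw [hj5]; decide
      · rw [hother k hk hkj]; decide)
    rw [hf.card_eq hsurj] at hnodd
    obtain rfl : n = 3 := by
      obtain ⟨k, hk⟩ := hnodd
      omega
    refine Or.inr (Or.inr (Or.inl ?_))
    have hH : ∀ f : ℕ → S, (∀ s, ∃ k < 3, f k = s) → M (f 0) (f 1) = 3 → M (f 1) (f 2) = 5 →
        M (f 0) (f 2) = 2 → M.SameType CoxeterMatrix.H₃ := by
      intro f hsurj h01 h12 h02
      refine sameType_of_forall_eq (fun i => f i) (fun s => ?_) fun a b => ?_
      · obtain ⟨k, hk, hks⟩ := hsurj s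
        exact ⟨⟨k, hk⟩, hks⟩
      · have h10 := (M.symmetric (f 1) (f 0)).trans h01
        have h21 := (M.symmetric (f 2) (f 1)).trans h12
        have h20 := (M.symmetric (f 2) (f 0)).trans h02
        fin_cases a <;> fin_cases b
        exacts [M.diagonal _, h01, h02, h10, M.diagonal _, h12, h20, h21, M.diagonal _]
    have h02 := hf.eq_two h (i := 0) (j := 2) le_rfl (by omega)
    by_cases hj0 : j = 0
    · subst hj0
      refine hH (fun i => f (2 - i)) (fun s => ?_) ?_ ?_ ?_
      · obtain ⟨k, hk, hks⟩ := hsurj s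
        exact ⟨2 - k, by omega, by rw [show 2 - (2 - k) = k by omega, hks]⟩
      · exact (M.symmetric _ _).trans (hother 1 (by omega) (by omega))
      · exact (M.symmetric _ _).trans hj5
      · exact (M.symmetric _ _).trans h02
    · obtain rfl : j = 1 := by omega
      exact hH f hsurj (hother 0 (by omega) (by omega)) hj5 h02

/-- The bound `hin` says that the side before the branch vertex is the shorter one. All labels are
3, so the rank `n + 1` is odd, and `i` separates type D, type E and the diagrams containing Ẽ₇. -/
theorem isDecomposableType_of_branch {f : ℕ → S} {n i : ℕ} (hf : M.IsPath f n) (hi : 0 < i)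
    (hin : 2 * i + 1 ≤ n) {u : S} (hu : ∀ k < n, f k ≠ u) (hui : M.coxeterGraph.Adj (f i) u)
    (hcov : ∀ s, s = u ∨ ∃ k < n, f k = s) {φ : W →* ℤˣ} (hφ : φ z = -1) :
    M.IsDecomposableType := by
  have hlab : ∀ k, k + 1 < n → M (f k) (f (k + 1)) = 3 := fun k hk =>
    hf.label_eq_three h hi (by omega) hu hui hk
  have hulab : ∀ k, k < n → M (f k) u = if k = i then 3 else 2 := fun k hk =>
    hf.branch_label h hi (by omega) hu hui hk
  have hodd : ∀ s t, M.coxeterGraph.Adj s t → Odd (M s t) := by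
    have h1 : ∀ k < n, M.coxeterGraph.Adj (f k) u → Odd (M (f k) u) := by
      intro k hk hadj
      have := h.three_le hadj
      have h2 := hulab k hk
      split_ifs at h2
      · rw [h2]; decide
      · omega
    intro s t hst
    rcases hcov s with rfl | ⟨a, ha, rfl⟩ <;> rcases hcov t with rfl | ⟨b, hb, rfl⟩
    · exact absurd rfl hst.ne
    · rw [M.symmetric]; exact h1 b hb hst.symm
    · exact h1 a ha hst
    · exact hf.forall_label h Odd (fun k hk => by rw [hlab k hk]; decide) ha hb hst
  have hcard := cs.odd_card_of_odd h hconn hz hφ hodd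
  rw [hf.card_eq_succ hu hcov] at hcard
  have hneven : n % 2 = 0 := by
    obtain ⟨k, hk⟩ := hcard
    omega
  rcases Nat.lt_or_ge i 2 with hi1 | hi2
  · -- type `D`
    exfalso
    obtain rfl : i = 1 := by omega
    have hidx : ∀ s, ∃ k < n, (s = u ∧ k = 0) ∨ f k = s := by
      intro s
      rcases hcov s with rfl | ⟨k, hk, hks⟩
      · exact ⟨0, by omega, Or.inl ⟨rfl, rfl⟩⟩
      · exact ⟨k, hk, Or.inr hks⟩
    choose g hgn hfg using hidx
    have hgf : ∀ k < n, g (f k) = k := by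
      intro k hk
      rcases hfg (f k) with ⟨h1, -⟩ | h1
      · exact absurd h1 (hu k hk)
      · exact hf.inj _ (hgn _) _ hk h1
    have hgu : g u = 0 := by
      rcases hfg u with ⟨-, h1⟩ | h1
      · exact h1
      · exact absurd h1 (hu _ (hgn u))
    -- Giving `u` the same height 0 as `f 0` folds D_{n+1} onto A_n.
    have hfold : IsFolding M n g := by
      refine ⟨fun k hk => ⟨f k, hgf k hk⟩, fun s t hs ht => absurd (hgn t) (by omega),
        fun s t hst ht => ?_, fun s t hst ht => ?_⟩
      · rcases hcov t with rfl | ⟨b, hb, rfl⟩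
        · omega
        rw [hgf b hb] at hst
        rcases hcov s with rfl | ⟨a, ha, rfl⟩
        · rw [M.symmetric, hulab b hb, if_neg (by omega)]
        · rw [hgf a ha] at hst
          rw [hf.eq_two h (by omega) hb]
      · rcases hcov t with rfl | ⟨b, hb, rfl⟩
        · omega
        rw [hgf b hb] at hst
        rcases hcov s with rfl | ⟨a, ha, rfl⟩
        · rw [M.symmetric, hulab b hb, if_pos (by omega)]
        · rw [hgf a ha] at hst
          subst hst
          rw [hlab a hb]
    have := hfold.eq_one cs (by omega) hz (φ := φ) fun s => by
      rw [if_pos (hgn s), cs.eq_signChar_of_odd hconn hφ hodd, signChar_simple]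
    rw [this] at hφ
    exact absurd hφ (by decide)
  rcases Nat.lt_or_ge i 3 with hi2' | hi3
  · obtain rfl : i = 2 := by omega
    have hn8 : n < 8 := by
      by_contra hn8
      -- This is Ẽ₈: 1/3 + 1/6 + 1/2 = 1. What remains is 5 ≤ n < 8 with `n` even.
      refine hf.false_of_branch_arms h (i := 2) (a := 1) (b := 4) (by omega) (by omega) hu hui ?_
      norm_num
    obtain rfl : n = 6 := by omega
    refine Or.inr (Or.inr (Or.inr ?_))
    refine sameType_of_forall_eq ![f 0, u, f 1, f 2, f 3, f 4, f 5] (fun s => ?_) ?_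
    · rcases hcov s with rfl | ⟨k, hk, rfl⟩
      · exact ⟨1, rfl⟩
      · interval_cases k
        exacts [⟨0, rfl⟩, ⟨2, rfl⟩, ⟨3, rfl⟩, ⟨4, rfl⟩, ⟨5, rfl⟩, ⟨6, rfl⟩]
    · have hlt : ∀ a b : Fin 7, a < b → M (![f 0, u, f 1, f 2, f 3, f 4, f 5] a)
          (![f 0, u, f 1, f 2, f 3, f 4, f 5] b) = CoxeterMatrix.E₇ a b := by
        have h2 : ∀ a b, a + 2 ≤ b → b < 6 → M (f a) (f b) = 2 := fun a b hab hb =>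
          hf.eq_two h hab hb
        have hu' : ∀ k < 6, M u (f k) = if k = 2 then 3 else 2 := fun k hk => by
          rw [M.symmetric]; exact hulab k hk
        intro a b hab
        fin_cases a <;> fin_cases b <;> first
          | exact absurd hab (by decide)
          | exact hulab _ (by norm_num)
          | exact hu' _ (by norm_num)
          | exact hlab _ (by norm_num)
          | exact h2 _ _ (by norm_num) (by norm_num)
      intro a b
      rcases lt_trichotomy a b with hab | rfl | hab
      · exact hlt a b hab
      · rw [M.diagonal, CoxeterMatrix.diagonal]
      · exact (M.symmetric _ _).trans ((hlt b a hab).trans (CoxeterMatrix.symmetric _ _ _))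
  · exfalso
    -- This is Ẽ₇: 1/4 + 1/4 + 1/2 = 1.
    refine hf.false_of_branch_arms h (i := i) (a := 2) (b := 2) (by omega) (by omega) hu hui ?_
    norm_num

theorem isDecomposableType_of_character [Nontrivial S] {φ : W →* ℤˣ} (hφ : φ z = -1) :
    M.IsDecomposableType := by
  obtain ⟨f, n, hf, hn1, hmax⟩ := exists_longest_isPath hconn
  by_cases hsurj : ∀ s, ∃ k < n, f k = s
  · have hn := hf.card_eq hsurj
    have := Fintype.one_lt_card (α := S)
    exact cs.isDecomposableType_of_path h hconn hz hf (by omega) hsurj hφ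
  · obtain ⟨i, hi, u, hu, hui⟩ : ∃ i < n, ∃ u, (∀ k < n, f k ≠ u) ∧ M.coxeterGraph.Adj (f i) u := by
      by_contra hcon
      push Not at hcon
      refine hsurj fun s => hconn.forall_of_adj (p := fun s => ∃ k < n, f k = s) ?_
        ⟨0, hn1, rfl⟩ s
      rintro _ v hkv ⟨k, hk, rfl⟩
      by_contra hv
      push Not at hv
      exact hcon k hk v hv hkv
    have hcov := hf.cover h hmax hi hu hui hconn
    obtain ⟨hi0, hin⟩ := hf.interior_of_adj hmax hi hu hui
    by_cases h2i : 2 * i + 1 ≤ n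
    · exact cs.isDecomposableType_of_branch h hconn hz hf hi0 h2i hu hui hcov hφ
    · refine cs.isDecomposableType_of_branch h hconn hz hf.reverse (i := n - 1 - i) (by omega)
        (by omega) (fun k hk => hu _ (by omega))
        (by rwa [show n - 1 - (n - 1 - i) = i by omega]) (fun s => ?_) hφ
      rcases hcov s with hs | ⟨k, hk, hks⟩
      · exact Or.inl hs
      · exact Or.inr ⟨n - 1 - k, by omega, by rw [show n - 1 - (n - 1 - k) = k by omega, hks]⟩

end CoxeterSystem

/-! ### Central elements and characters in the listed types. -/

namespace CoxeterMatrix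

theorem IsSpherical.of_sameType {S S' : Type*} {M : CoxeterMatrix S} {N : CoxeterMatrix S'}
    (h : M.IsSpherical) (hMN : M.SameType N) : N.IsSpherical := by
  obtain ⟨e, rfl⟩ := hMN
  exact Matrix.PosDef.submatrix h e.symm.injective

theorem SameType.nonempty_coxeterSystem {S S' : Type*} {M : CoxeterMatrix S} {N : CoxeterMatrix S'}
    (hMN : M.SameType N) {W : Type*} [Group W] (cs : CoxeterSystem M W) :
    Nonempty (CoxeterSystem N W) := by
  obtain ⟨e, rfl⟩ := hMN
  exact ⟨cs.reindex e⟩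

theorem rootForm_simpleRoot_left {S : Type*} [Fintype S] [DecidableEq S] {M : CoxeterMatrix S}
    (s : S) (x : S → ℝ) : M.rootForm (simpleRoot s) x = ∑ t, M.canonicalForm s t * x t := by
  rw [rootForm_apply, Finset.sum_eq_single s]
  · simp [simpleRoot]
  · intro t _ hts
    simp [simpleRoot_apply, hts]
  · simp

end CoxeterMatrix

namespace CoxeterSystem

open CoxeterMatrix

section General

variable {S : Type*} [Fintype S] [DecidableEq S] {M : CoxeterMatrix S}
  {W : Type*} [Group W] (cs : CoxeterSystem M W) (h : M.IsSpherical)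

theorem geomRep_eq_neg_one {z : W}
    (hz : ∀ s, cs.geomRep h z (simpleRoot s) = -simpleRoot s) : cs.geomRep h z = -1 := by
  apply LinearMap.pi_ext'
  intro s
  ext1
  simpa [simpleRoot] using hz s

include h in
theorem exists_character_of_geomRep {z : W} (hz : cs.geomRep h z = -1)
    (hcard : Odd (Fintype.card S)) :
    ∃ z ∈ Subgroup.center W, ∃ φ : W →* ℤˣ, φ z = -1 :=
  ⟨z, cs.mem_center_of_geomRep h hz, cs.signChar, by
    rw [cs.signChar_of_geomRep h hz, hcard.neg_one_pow]⟩

end General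

/-! ### Type `I₂(p)` -/

/-- The reflections invert the rotation `c`, and its power with exponent p/2 = 2k + 1 is its own
inverse, hence central. As p is even, -1 and 1 may be assigned freely to the two generators; the odd
power of `c` then gets -1. -/
theorem exists_character_I {m : ℕ} (hm : (m + 2) % 4 = 2) {W : Type*} [Group W]
    (cs : CoxeterSystem (CoxeterMatrix.I m) W) :
    ∃ z ∈ Subgroup.center W, ∃ φ : W →* ℤˣ, φ z = -1 := by
  have hM : ∀ a b : Fin 2, CoxeterMatrix.I m a b = if a = b then 1 else m + 2 := fun _ _ => rfl
  obtain ⟨k, hk⟩ : ∃ k, m + 2 = 2 * (2 * k + 1) := ⟨m / 4, by omega⟩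
  have hlift : (CoxeterMatrix.I m).IsLiftable fun s => if s = 0 then (-1 : ℤˣ) else 1 := by
    intro s t
    have hsq : ∀ x : ℤˣ, x ^ (m + 2) = 1 := fun x => by rw [hk, pow_mul, Int.units_sq, one_pow]
    change _ ^ (CoxeterMatrix.I m s t) = 1
    rw [hM]
    split_ifs with hst
    · subst hst; rw [pow_one, Int.units_mul_self]
    · exact hsq _
  set c := cs.simple 0 * cs.simple 1 with hc
  have hcp : c ^ (m + 2) = 1 := cs.simple_mul_simple_pow 0 1
  set z := c ^ (2 * k + 1) with hz
  have hzz : z⁻¹ = z := by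
    rw [inv_eq_iff_mul_eq_one, hz, ← pow_add, ← two_mul, ← hk, hcp]
  have hc' : c⁻¹ = cs.simple 1 * cs.simple 0 := by simp [hc]
  have hconj : ∀ s : Fin 2, cs.simple s * c * (cs.simple s)⁻¹ = c⁻¹ := by
    intro s
    rw [hc']
    fin_cases s
    · simp [hc]
    · simp [hc, mul_assoc]
  refine ⟨z, ?_, cs.lift ⟨_, hlift⟩, ?_⟩
  · rw [cs.mem_center_iff]
    intro s
    have : cs.simple s * z * (cs.simple s)⁻¹ = z := by
      rw [hz, ← conj_pow, hconj, inv_pow, ← hz, hzz]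
    exact (mul_inv_eq_iff_eq_mul.1 this).symm
  · rw [hz, hc, map_pow, map_mul, cs.lift_apply_simple hlift, cs.lift_apply_simple hlift]
    rw [if_pos rfl, if_neg (by decide), mul_one, pow_succ, pow_mul, Int.units_sq, one_pow, one_mul]

/-! ### Type `B_n` -/

section TypeB

variable {S : Type*} [Fintype S] [DecidableEq S] {M : CoxeterMatrix S}
  {W : Type*} [Group W] (cs : CoxeterSystem M W) (h : M.IsSpherical) (f : ℕ → S)

/-- The short roots of a system of type `B_n`. -/
noncomputable def shortRoot (f : ℕ → S) : ℕ → S → ℝ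
  | 0 => simpleRoot (f 0)
  | k + 1 => shortRoot f k + √2 • simpleRoot (f (k + 1))

variable {f} {n : ℕ}
  (hM : ∀ k < n, ∀ l < n, M (f k) (f l) = if k = l then 1 else
    if k + l = 1 then 4 else if k + 1 = l ∨ l + 1 = k then 3 else 2)

include hM

omit [Fintype S] [DecidableEq S] in
theorem canonicalForm_typeB {k l : ℕ} (hk : k < n) (hl : l < n) :
    M.canonicalForm (f k) (f l) = if k = l then 1 else
      if k + l = 1 then -(√2 / 2)
      else if k + 1 = l ∨ l + 1 = k then -(1 / 2) else 0 := by
  have := hM k hk l hl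
  split_ifs at this ⊢ <;> simp [canonicalForm, this]

theorem rootForm_shortRoot_zero {l : ℕ} (hl : l < n) :
    M.rootForm (simpleRoot (f 0)) (shortRoot f l) = if l = 0 then 1 else 0 := by
  have h2 : √2 * √2 = 2 := Real.mul_self_sqrt (by norm_num)
  induction l with
  | zero => simp [shortRoot]
  | succ l ih =>
    rw [shortRoot, map_add, map_smul, ih (by omega), rootForm_simpleRoot,
      canonicalForm_typeB hM (by omega) hl, smul_eq_mul]
    rcases Nat.eq_zero_or_pos l with rfl | hl0
    · norm_num; linarith
    · rw [if_neg (by omega), if_neg (by omega), if_neg (by omega), if_neg (by omega),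
        if_neg (by omega)]
      simp

theorem rootForm_shortRoot_succ {k l : ℕ} (hk : k + 1 < n) (hl : l < n) :
    M.rootForm (simpleRoot (f (k + 1))) (shortRoot f l) =
      if l = k then -(√2 / 2) else if l = k + 1 then √2 / 2 else 0 := by
  have h2 : √2 * √2 = 2 := Real.mul_self_sqrt (by norm_num)
  induction l with
  | zero =>
    rw [shortRoot, rootForm_simpleRoot, canonicalForm_typeB hM hk hl]
    rcases Nat.eq_zero_or_pos k with rfl | hk0
    · simp
    · rw [if_neg (by omega), if_neg (by omega), if_neg (by omega), if_neg (by omega),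
        if_neg (by omega)]
  | succ l ih =>
    rw [shortRoot, map_add, map_smul, ih (by omega), rootForm_simpleRoot,
      canonicalForm_typeB hM hk hl, smul_eq_mul]
    split_ifs <;> first | omega | ring


omit hM

theorem simpleRoot_succ (k : ℕ) :
    simpleRoot (f (k + 1)) = (√2)⁻¹ • (shortRoot f (k + 1) - shortRoot f k) := by
  rw [shortRoot, add_sub_cancel_left, inv_smul_smul₀ (by positivity)]

include hM

/-- The simple reflections act on the short roots as signed permutations: this one flips the first,
the others swap neighbours. Conjugates of the flip change each sign separately, and their product is
-1. -/
theorem simpleReflection_shortRoot_zero {l : ℕ} (hl : l < n) :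
    M.simpleReflection (f 0) (shortRoot f l) = if l = 0 then -shortRoot f l else shortRoot f l := by
  rw [simpleReflection_apply, rootForm_shortRoot_zero hM hl]
  split_ifs with hl0
  · subst hl0
    simp only [shortRoot]
    module
  · simp

theorem simpleReflection_shortRoot_succ {k l : ℕ} (hk : k + 1 < n) (hl : l < n) :
    M.simpleReflection (f (k + 1)) (shortRoot f l) =
      shortRoot f (if l = k then k + 1 else if l = k + 1 then k else l) := by
  rw [simpleReflection_apply, rootForm_shortRoot_succ hM hk hl]
  split_ifs with h1 h2
  · subst h1
    rw [shortRoot]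
    module
  · subst h2
    rw [shortRoot]
    module
  · simp

theorem exists_flip_shortRoot {k : ℕ} (hk : k < n) : ∃ w, ∀ l < n,
    cs.geomRep h w (shortRoot f l) = if l = k then -shortRoot f l else shortRoot f l := by
  induction k with
  | zero =>
    refine ⟨cs.simple (f 0), fun l hl => ?_⟩
    rw [geomRep_simple, simpleReflection_shortRoot_zero hM hl]
  | succ k ih =>
    obtain ⟨w, hw⟩ := ih (by omega)
    refine ⟨cs.simple (f (k + 1)) * w * cs.simple (f (k + 1)), fun l hl => ?_⟩
    have hs := fun {l} (hl : l < n) => simpleReflection_shortRoot_succ hM hk hl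
    have hk0 : M.simpleReflection (f (k + 1)) (shortRoot f k) = shortRoot f (k + 1) := by
      rw [hs (by omega), if_pos rfl]
    have hk1 : M.simpleReflection (f (k + 1)) (shortRoot f (k + 1)) = shortRoot f k := by
      rw [hs hk, if_neg (by omega), if_pos rfl]
    rw [map_mul, map_mul, Module.End.mul_apply, Module.End.mul_apply, geomRep_simple]
    by_cases h1 : l = k + 1
    · subst h1
      rw [if_pos rfl, hk1, hw k (by omega), if_pos rfl, map_neg, hk0]
    rw [if_neg h1]
    by_cases h2 : l = k
    · subst h2
      rw [hk0, hw _ hk, if_neg (by omega), hk1]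
    · have hl' : M.simpleReflection (f (k + 1)) (shortRoot f l) = shortRoot f l := by
        rw [hs hl, if_neg h2, if_neg h1]
      rw [hl', hw l hl, if_neg h2, hl']

theorem exists_flip_shortRoot_lt {m : ℕ} (hm : m ≤ n) : ∃ w, ∀ l < n,
    cs.geomRep h w (shortRoot f l) = if l < m then -shortRoot f l else shortRoot f l := by
  induction m with
  | zero => exact ⟨1, fun l _ => by simp⟩
  | succ m ih =>
    obtain ⟨w, hw⟩ := ih (by omega)
    obtain ⟨v, hv⟩ := cs.exists_flip_shortRoot h hM (k := m) hm
    refine ⟨v * w, fun l hl => ?_⟩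
    rw [map_mul, Module.End.mul_apply, hw l hl]
    split_ifs with h1 h2 h2
    · rw [map_neg, hv l hl, if_neg (by omega)]
    · omega
    · rw [hv l hl, if_pos (by omega)]
    · rw [hv l hl, if_neg (by omega)]

theorem exists_geomRep_eq_neg_one_typeB (hsurj : ∀ s, ∃ k < n, f k = s) :
    ∃ w, cs.geomRep h w = -1 := by
  obtain ⟨w, hw⟩ := cs.exists_flip_shortRoot_lt h hM le_rfl
  refine ⟨w, cs.geomRep_eq_neg_one h fun s => ?_⟩
  have hw' : ∀ l < n, cs.geomRep h w (shortRoot f l) = -shortRoot f l := fun l hl => by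
    rw [hw l hl, if_pos hl]
  obtain ⟨k, hk, rfl⟩ := hsurj s
  rcases k with _ | k
  · exact hw' 0 hk
  · rw [simpleRoot_succ, map_smul, map_sub, hw' _ hk, hw' _ (by omega)]
    module

end TypeB

theorem exists_character_B {n : ℕ} (hn : 3 ≤ n) (hodd : Odd n) {W : Type*} [Group W]
    (cs : CoxeterSystem (CoxeterMatrix.B n) W) (h : (CoxeterMatrix.B n).IsSpherical) :
    ∃ z ∈ Subgroup.center W, ∃ φ : W →* ℤˣ, φ z = -1 := by
  -- `CoxeterMatrix.B n` has its label 4 on the last edge; the numbering is reversed to put it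
  -- first.
  have hM : ∀ k < n, ∀ l < n, CoxeterMatrix.B n (⟨n - 1 - k, by omega⟩ : Fin n)
      (⟨n - 1 - l, by omega⟩ : Fin n) = if k = l then 1 else
        if k + l = 1 then 4 else if k + 1 = l ∨ l + 1 = k then 3 else 2 := by
    intro k hk l hl
    change (if (⟨n - 1 - k, _⟩ : Fin n) = ⟨n - 1 - l, _⟩ then 1 else
      if n - 1 - k = n - 1 ∧ n - 1 - l = n - 2 ∨ n - 1 - l = n - 1 ∧ n - 1 - k = n - 2 then 4
      else if n - 1 - l + 1 = n - 1 - k ∨ n - 1 - k + 1 = n - 1 - l then 3 else 2) = _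
    simp only [Fin.mk.injEq]
    split_ifs <;> omega
  obtain ⟨z, hz⟩ := cs.exists_geomRep_eq_neg_one_typeB h
    (f := fun k => (⟨n - 1 - k, by omega⟩ : Fin n)) hM fun s =>
      ⟨n - 1 - s, by omega, Fin.ext (by
        have := s.2
        change n - 1 - (n - 1 - (s : ℕ)) = s
        omega)⟩
  exact cs.exists_character_of_geomRep h hz (by simpa using hodd)

/-! ### Type `H₃` -/

/-- The product of the reflections in three mutually orthogonal roots is -1. Two of them are `α₀`
and `α₂`; the third is found as `w α₁`, with coefficients in the golden ratio. -/
theorem exists_character_H₃ {W : Type*} [Group W]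
    (cs : CoxeterSystem CoxeterMatrix.H₃ W) (h : CoxeterMatrix.H₃.IsSpherical) :
    ∃ z ∈ Subgroup.center W, ∃ φ : W →* ℤˣ, φ z = -1 := by
  set τ : ℝ := (1 + √5) / 2 with hτ
  have hτ2 : τ ^ 2 = τ + 1 := by
    have h5 : √5 ^ 2 = 5 := Real.sq_sqrt (by norm_num)
    rw [hτ]; linear_combination (1 / 4) * h5
  have hτ0 : 0 < τ := by rw [hτ]; positivity
  have hcos : cos (π / 5) = τ / 2 := by rw [cos_pi_div_five, hτ]; ring
  clear_value τ
  have hc : ∀ a b : Fin 3, CoxeterMatrix.H₃.canonicalForm a b =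
      !![1, -(1 / 2), 0; -(1 / 2), 1, -(τ / 2); 0, -(τ / 2), 1] a b := by
    intro a b
    fin_cases a <;> fin_cases b <;> simp [canonicalForm, H₃, hcos]
  set v : ℝ → ℝ → ℝ → Fin 3 → ℝ := fun a b c =>
    a • simpleRoot 0 + b • simpleRoot 1 + c • simpleRoot 2 with hv
  have h0 : ∀ a b c, cs.geomRep h (cs.simple 0) (v a b c) = v (b - a) b c := by
    intro a b c
    simp only [hv, geomRep_simple, map_add, map_smul, simpleReflection_simpleRoot, hc]
    simp
    module
  have h1 : ∀ a b c, cs.geomRep h (cs.simple 1) (v a b c) = v a (a + τ * c - b) c := by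
    intro a b c
    simp only [hv, geomRep_simple, map_add, map_smul, simpleReflection_simpleRoot, hc]
    simp
    module
  have h2 : ∀ a b c, cs.geomRep h (cs.simple 2) (v a b c) = v a b (τ * b - c) := by
    intro a b c
    simp only [hv, geomRep_simple, map_add, map_smul, simpleReflection_simpleRoot, hc]
    simp
    module
  set w := cs.simple 1 * cs.simple 0 * cs.simple 2 * cs.simple 1 * cs.simple 0 * cs.simple 2
    with hw
  have hv1 : simpleRoot 1 = v 0 1 0 := by simp [hv]
  have hβ : cs.geomRep h w (simpleRoot 1) = v τ (2 * τ) (τ + 1) := by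
    rw [hv1, hw]
    simp only [map_mul, Module.End.mul_apply, h0, h1, h2]
    congr 1
    · linear_combination hτ2
    · linear_combination (τ ^ 2 + τ + 1) * hτ2
    · linear_combination (τ + 1) * hτ2
  have hβr : ∀ a b c, CoxeterMatrix.H₃.rootForm (v τ (2 * τ) (τ + 1)) (v a b c) =
      b * (τ - 1) / 2 := by
    intro a b c
    simp only [hv, map_add, map_smul, LinearMap.add_apply, LinearMap.smul_apply,
      rootForm_simpleRoot, hc, smul_eq_mul]
    simp
    linear_combination (-b / 2 - c) * hτ2
  set t := w * cs.simple 1 * w⁻¹ with ht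
  have hta : ∀ a c, cs.geomRep h t (v a 0 c) = v a 0 c := by
    intro a c
    rw [ht, geomRep_conj_simple, hβ, hβr]
    simp
  have htβ : cs.geomRep h t (v τ (2 * τ) (τ + 1)) = -v τ (2 * τ) (τ + 1) := by
    rw [ht, ← hβ, map_mul, map_mul, Module.End.mul_apply, Module.End.mul_apply,
      geomRep_inv_apply_self, geomRep_simple_simpleRoot_self, map_neg]
  set z := cs.simple 0 * cs.simple 2 * t with hz
  have hneg : ∀ a b c, -v a b c = v (-a) (-b) (-c) := by
    intro a b c
    simp only [hv]
    module
  have hza : ∀ a c, cs.geomRep h z (v a 0 c) = -v a 0 c := by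
    intro a c
    simp only [hz, map_mul, Module.End.mul_apply, hta, h2, h0, hneg]
    congr 1 <;> ring
  have hzβ : cs.geomRep h z (v τ (2 * τ) (τ + 1)) = -v τ (2 * τ) (τ + 1) := by
    simp only [hz, map_mul, Module.End.mul_apply, htβ, map_neg, h2, h0]
    congr 2
    · ring
    · linear_combination 2 * hτ2
  refine cs.exists_character_of_geomRep h (z := z) (cs.geomRep_eq_neg_one h fun s => ?_)
    (by simp; decide)
  fin_cases s
  · have := hza 1 0
    simpa [hv] using this
  -- `α₁` is recovered from the third orthogonal root and vectors in the plane of `α₀`, `α₂`.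
  · have e : simpleRoot (1 : Fin 3) =
        (2 * τ)⁻¹ • (v τ (2 * τ) (τ + 1) - v τ 0 (τ + 1)) := by
      rw [eq_inv_smul_iff₀ (by positivity)]
      simp only [hv]
      module
    change cs.geomRep h z (simpleRoot 1) = -simpleRoot 1
    rw [e, map_smul, map_sub, hzβ, hza]
    module
  · have := hza 0 1
    simpa [hv] using this

/-! ### Type `E₇` -/

/-- The ninth power of a Coxeter element is -1. -/
theorem exists_character_E₇ {W : Type*} [Group W]
    (cs : CoxeterSystem CoxeterMatrix.E₇ W) (h : CoxeterMatrix.E₇.IsSpherical) :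
    ∃ z ∈ Subgroup.center W, ∃ φ : W →* ℤˣ, φ z = -1 := by
  -- `C` is the integer matrix of the product of the simple reflections in the order 0, …, 6, and
  -- `C₃` is its cube; the ninth power is computed as a cube of a cube.
  set C : Matrix (Fin 7) (Fin 7) ℤ :=
    !![0, 1, 0, 0, 0, 0, -1; 0, 0, 1, 0, 0, 0, -1; 1, 1, 0, 0, 0, 0, -1; 0, 1, 1, 0, 0, 0, -1;
      0, 0, 0, 1, 0, 0, -1; 0, 0, 0, 0, 1, 0, -1; 0, 0, 0, 0, 0, 1, -1] with hC
  set C₃ : Matrix (Fin 7) (Fin 7) ℤ :=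
    !![1, 1, 0, 0, -1, 0, 0; 0, 1, 1, 0, -1, 0, -1; 1, 1, 1, 0, -1, -1, 0;
      1, 2, 1, 0, -1, -1, -1; 1, 1, 1, 0, -1, 0, -1; 0, 1, 1, 0, -1, 0, 0;
      0, 0, 0, 1, -1, 0, 0] with hC₃
  have h3 : C ^ 3 = C₃ := by decide +kernel
  have h9 : C₃ ^ 3 = -1 := by decide +kernel
  have hC9 : C ^ 9 = -1 := by rw [show 9 = 3 * 3 by norm_num, pow_mul, h3, h9]
  have hG : ∀ a b : Fin 7, CoxeterMatrix.E₇.canonicalForm a b =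
      !![1, 0, -(1 / 2), 0, 0, 0, 0; 0, 1, 0, -(1 / 2), 0, 0, 0;
      -(1 / 2), 0, 1, -(1 / 2), 0, 0, 0; 0, -(1 / 2), -(1 / 2), 1, -(1 / 2), 0, 0;
      0, 0, 0, -(1 / 2), 1, -(1 / 2), 0; 0, 0, 0, 0, -(1 / 2), 1, -(1 / 2);
      0, 0, 0, 0, 0, -(1 / 2), 1] a b := by
    intro a b
    fin_cases a <;> fin_cases b <;> simp [canonicalForm, E₇]
  have hrefl : ∀ (s : Fin 7) (x : Fin 7 → ℝ), cs.geomRep h (cs.simple s) x =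
      Function.update x s (x s - 2 * ∑ t, CoxeterMatrix.E₇.canonicalForm s t * x t) := by
    intro s x
    rw [geomRep_simple, simpleReflection_apply, rootForm_simpleRoot_left]
    ext i
    by_cases his : i = s
    · subst his; simp [simpleRoot_apply]
    · simp [simpleRoot_apply, his]
  have hs0 : ∀ x0 x1 x2 x3 x4 x5 x6 : ℝ,
      cs.geomRep h (cs.simple 0) ![x0, x1, x2, x3, x4, x5, x6] =
        ![x2 - x0, x1, x2, x3, x4, x5, x6] := by
    intro x0 x1 x2 x3 x4 x5 x6
    rw [hrefl]
    ext i
    fin_cases i <;> simp [hG, Fin.sum_univ_seven]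
    ring
  have hs1 : ∀ x0 x1 x2 x3 x4 x5 x6 : ℝ,
      cs.geomRep h (cs.simple 1) ![x0, x1, x2, x3, x4, x5, x6] =
        ![x0, x3 - x1, x2, x3, x4, x5, x6] := by
    intro x0 x1 x2 x3 x4 x5 x6
    rw [hrefl]
    ext i
    fin_cases i <;> simp [hG, Fin.sum_univ_seven]
    ring
  have hs2 : ∀ x0 x1 x2 x3 x4 x5 x6 : ℝ,
      cs.geomRep h (cs.simple 2) ![x0, x1, x2, x3, x4, x5, x6] =
        ![x0, x1, x0 + x3 - x2, x3, x4, x5, x6] := by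
    intro x0 x1 x2 x3 x4 x5 x6
    rw [hrefl]
    ext i
    fin_cases i <;> simp [hG, Fin.sum_univ_seven]
    ring
  have hs3 : ∀ x0 x1 x2 x3 x4 x5 x6 : ℝ,
      cs.geomRep h (cs.simple 3) ![x0, x1, x2, x3, x4, x5, x6] =
        ![x0, x1, x2, x1 + x2 + x4 - x3, x4, x5, x6] := by
    intro x0 x1 x2 x3 x4 x5 x6
    rw [hrefl]
    ext i
    fin_cases i <;> simp [hG, Fin.sum_univ_seven]
    ring
  have hs4 : ∀ x0 x1 x2 x3 x4 x5 x6 : ℝ,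
      cs.geomRep h (cs.simple 4) ![x0, x1, x2, x3, x4, x5, x6] =
        ![x0, x1, x2, x3, x3 + x5 - x4, x5, x6] := by
    intro x0 x1 x2 x3 x4 x5 x6
    rw [hrefl]
    ext i
    fin_cases i <;> simp [hG, Fin.sum_univ_seven]
    ring
  have hs5 : ∀ x0 x1 x2 x3 x4 x5 x6 : ℝ,
      cs.geomRep h (cs.simple 5) ![x0, x1, x2, x3, x4, x5, x6] =
        ![x0, x1, x2, x3, x4, x4 + x6 - x5, x6] := by
    intro x0 x1 x2 x3 x4 x5 x6
    rw [hrefl]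
    ext i
    fin_cases i <;> simp [hG, Fin.sum_univ_seven]
    ring
  have hs6 : ∀ x0 x1 x2 x3 x4 x5 x6 : ℝ,
      cs.geomRep h (cs.simple 6) ![x0, x1, x2, x3, x4, x5, x6] =
        ![x0, x1, x2, x3, x4, x5, x5 - x6] := by
    intro x0 x1 x2 x3 x4 x5 x6
    rw [hrefl]
    ext i
    fin_cases i <;> simp [hG, Fin.sum_univ_seven]
    ring
  set c := cs.simple 0 * cs.simple 1 * cs.simple 2 * cs.simple 3 * cs.simple 4 * cs.simple 5 *
    cs.simple 6 with hc
  have hcC : cs.geomRep h c = Matrix.toLin' (C.map (Int.castRingHom ℝ)) := by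
    apply LinearMap.ext
    intro x
    obtain ⟨x0, x1, x2, x3, x4, x5, x6, rfl⟩ : ∃ x0 x1 x2 x3 x4 x5 x6,
        x = ![x0, x1, x2, x3, x4, x5, x6] :=
      ⟨x 0, x 1, x 2, x 3, x 4, x 5, x 6, by ext i; fin_cases i <;> rfl⟩
    simp only [hc, map_mul, Module.End.mul_apply, hs0, hs1, hs2, hs3, hs4, hs5, hs6]
    ext i
    fin_cases i <;>
      simp [hC, Matrix.mulVec, dotProduct, Fin.sum_univ_seven] <;> ring
  refine cs.exists_character_of_geomRep h (z := c ^ 9) ?_ (by simp; decide)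
  have hmap : (-1 : Matrix (Fin 7) (Fin 7) ℤ).map (Int.castRingHom ℝ) = -1 := by
    rw [← RingHom.mapMatrix_apply, map_neg, map_one]
  rw [map_pow, hcC, ← Matrix.toLin'_pow, ← Matrix.map_pow, hC9, hmap, map_neg, Matrix.toLin'_one]
  rfl

/-! ### The main theorem -/

theorem exists_character_of_isDecomposableType {S : Type*} {M : CoxeterMatrix S}
    (h : M.IsSpherical) {W : Type*} [Group W] (cs : CoxeterSystem M W)
    (hM : M.IsDecomposableType) : ∃ z ∈ Subgroup.center W, ∃ φ : W →* ℤˣ, φ z = -1 := by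
  rcases hM with ⟨m, -, hm, hMN⟩ | ⟨n, hn, hodd, hMN⟩ | hMN | hMN <;>
    obtain ⟨cs'⟩ := hMN.nonempty_coxeterSystem cs
  · exact exists_character_I hm cs'
  · exact exists_character_B hn hodd cs' (h.of_sameType hMN)
  · exact exists_character_H₃ cs' (h.of_sameType hMN)
  · exact exists_character_E₇ cs' (h.of_sameType hMN)

theorem center_ne_top {S : Type*} [Fintype S] [DecidableEq S] [Nontrivial S] {M : CoxeterMatrix S}
    (h : M.IsSpherical) (hconn : M.coxeterGraph.Connected) {W : Type*} [Group W]
    (cs : CoxeterSystem M W) : Subgroup.center W ≠ ⊤ := by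
  intro htop
  obtain ⟨s⟩ := hconn.nonempty
  obtain ⟨t, hst⟩ := hconn.preconnected.exists_adj_of_nontrivial s
  refine cs.not_commute_of_adj h hst (Subgroup.commute_of_mem_center ?_)
  rw [htop]
  trivial

theorem center_eq_top {S : Type*} [Fintype S] [DecidableEq S] [Subsingleton S] {M : CoxeterMatrix S} {W : Type*} [Group W]
    (cs : CoxeterSystem M W) : Subgroup.center W = ⊤ := by
  rw [eq_top_iff, ← cs.subgroup_closure_range_simple, Subgroup.closure_le]
  rintro _ ⟨s, rfl⟩
  rw [SetLike.mem_coe, cs.mem_center_iff]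
  intro t
  rw [Subsingleton.elim s t]

end CoxeterSystem

theorem CoxeterMatrix.IsDecomposableType.nontrivial {S : Type*} {M : CoxeterMatrix S}
    (hM : M.IsDecomposableType) : Nontrivial S := by
  rcases hM with ⟨m, -, -, e, -⟩ | ⟨n, hn, -, e, -⟩ | ⟨e, -⟩ | ⟨e, -⟩
  · exact e.nontrivial
  · have : Nontrivial (Fin n) := Fin.nontrivial_iff_two_le.2 (by omega)
    exact e.nontrivial
  · exact e.nontrivial
  · exact e.nontrivial

/-- `CoxeterMatrix.I m` is the Coxeter matrix of type `I₂(m + 2)`. -/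
theorem theorem7p2 {S : Type*} [Finite S] (M : CoxeterMatrix S)
    (hconn : M.coxeterGraph.Connected) (hsph : M.IsSpherical)
    {W : Type*} [Group W] (cs : CoxeterSystem M W) :
    (IsDecomposableGroup W ↔
      (∃ m : ℕ, 6 ≤ m + 2 ∧ (m + 2) % 4 = 2 ∧ M.SameType (CoxeterMatrix.I m)) ∨
      (∃ n : ℕ, 3 ≤ n ∧ Odd n ∧ M.SameType (CoxeterMatrix.B n)) ∨
      M.SameType CoxeterMatrix.H₃ ∨
      M.SameType CoxeterMatrix.E₇) ∧
    (IsDecomposableGroup W →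
      (∃ H : Fin 2 → Subgroup W, IsRemakDecomposition H ∧
        Nonempty (H 0 ≃* Subgroup.center W) ∧ Nonempty (H 1 ≃* W ⧸ Subgroup.center W)) ∧
      (∀ (q : ℕ) (H : Fin q → Subgroup W), IsRemakDecomposition H →
        q = 2 ∧ ∃ i j : Fin q, i ≠ j ∧
          Nonempty (H i ≃* Subgroup.center W) ∧ Nonempty (H j ≃* W ⧸ Subgroup.center W))) := by
  classical
  have := Fintype.ofFinite S
  have hdir := fun H K => cs.le_center_or_le_center hsph hconn (H := H) (K := K)
  have hcen : ∀ y ∈ Subgroup.center W, y ≠ 1 → ∀ z ∈ Subgroup.center W, z ≠ 1 → y = z :=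
    fun y hy hy1 z hz hz1 => cs.eq_of_mem_center hsph hconn hy hy1 hz hz1
  refine ⟨?_, fun hW => ⟨exists_isRemakDecomposition_center hdir hcen hW,
    fun q H hH => hH.eq_two hdir hcen hW⟩⟩
  change _ ↔ M.IsDecomposableType
  constructor
  · intro hW
    rcases subsingleton_or_nontrivial S with hS | hS
    -- In rank one `W` is its own centre, which has no subgroups besides ⊥ and itself.
    · refine absurd (fun H _ => ?_) hW
      have htop := cs.center_eq_top
      rw [← htop]
      exact eq_bot_or_eq_center hcen (htop ▸ le_top)
    · obtain ⟨z, hz, φ, hφ⟩ :=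
        (isDecomposableGroup_iff hdir hcen (cs.center_ne_top hsph hconn)).1 hW
      exact cs.isDecomposableType_of_character hsph hconn hz hφ
  · intro hM
    have := hM.nontrivial
    exact (isDecomposableGroup_iff hdir hcen (cs.center_ne_top hsph hconn)).2
      (cs.exists_character_of_isDecomposableType hsph hM)
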